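/- **Notation.** For $n\ge 0$ let $$h_{2n}(x)=\sum_{k=0}^{n}(-1)^{n-k}\,2^{-n+3k+\frac14}\,\frac{((2n)!)^{1/2}}{(2k)!\,(n-k)!}\,\pi^k x^{2k}e^{-\pi x^2}$$ be the normalized even Hermite functions, and for $\ell\ge 0$ let $$\psi^+_\ell=h_{4\ell}-\frac{h_{4\ell}(0)}{h_0(0)}\,h_0,\qquad \psi^-_\ell=-h_{4\ell+2}+\frac{h_{4\ell+2}(0)}{h_2(0)}\,h_2 .$$ For $u>0$ put $\mathcal E(f)(u)=u^{1/2}\sum_{n\ge1}f(nu)$, and put $\mathbb F_\mu(f)(s)=\int_0^\infty f(u)\,u^{-is}\,\frac{du}{u}$ (the Mellin transform of $f$ at $-is$). Let $\Xi$ be the entire function $\Xi(s)=\frac{z(z-1)}2\Gamma(z/2)\pi^{-z/2}\zeta(z)$, $z=\frac12+is$. Write $(a)_k=\prod_{j=0}^{k-1}(a+j)$ and $a=a(s)=\frac14-\frac{is}2$, and define the polynomials $$\mathcal P_m(s)=\sqrt{(2m)!}\sum_{k=0}^m(-1)^k2^{3k-m}\frac{(a)_k}{(2k)!\,(m-k)!},$$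 $$P^+_\ell(s)=\sum_{k=1}^{2\ell}(-1)^k2^{-2\ell+3k-\frac34}\frac{((4\ell)!)^{1/2}}{(2\ell-k)!\,(2k)!}(a)_k,$$ $$P^-_\ell(s)=-\frac{\ell\,2^{-2\ell+\frac54}((4\ell+2)!)^{1/2}}{(2\ell+1)!}\,a+\sum_{k=2}^{2\ell+1}(-1)^k2^{3k-2\ell-\frac74}\frac{((4\ell+2)!)^{1/2}}{(2\ell+1-k)!\,(2k)!}(a)_k .$$ Let $\mathcal H_{\le1}$ be the topological ring of entire functions of order $\le 1$, i.e. of entire $f$ such that $p_\varepsilon(f)=\sup_{z\in\mathbb C}|f(z)|e^{-|z|^{1+\varepsilon}}<\infty$ for every $\varepsilon>0$, with the topology defined by the norms $p_\varepsilon$. **Proposition.** One has $P^+_\ell(s)=2^{-3/4}\big(\mathcal P_{2\ell}(s)-\mathcal P_{2\ell}(\tfrac i2)\big)$ and $P^-_\ell(s)=2^{-3/4}\big(\mathcal P_{2\ell+1}(s)+2is\,\mathcal P_{2\ell+1}(\tfrac i2)\big)$; both are divisible by $\frac14+s^2$, so that $P^\pm_\ell(s)=-\frac12\left(\frac14+s^2\right)R^\pm_\ell(s)$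 defines polynomials $R^\pm_\ell$, and the $R^\pm_\ell$, $\ell\ge0$, span $\mathbb C[s]$. Moreover: (i) For all $\ell\ge0$ the series $\mathcal E(\psi^\pm_\ell)(u)$ converge for every $u>0$, and for every $s\in\mathbb C$ the integral defining $\mathbb F_\mu(\mathcal E(\psi^\pm_\ell))(s)$ converges absolutely, and $$\mathbb F_\mu(\mathcal E(\psi^\pm_\ell))(s)=R^\pm_\ell(s)\,\Xi(s).$$ (ii) The functions $\mathbb F_\mu(\mathcal E(\psi^\pm_\ell))$ belong to $\mathcal H_{\le1}$, the closure $V$ in $\mathcal H_{\le1}$ of their linear span is stable under multiplication by $s$, and the spectrum of the operator of multiplication by $s$ in the quotient $\mathcal H_{\le1}/V$ (the set of $\lambda\in\mathbb C$ such that $s-\lambda$ is not invertible in the algebra of continuous linear operators of $\mathcal H_{\le1}/V$) is the set of $s\in\mathbb C$ such that $\frac12+is$ is a nontrivial zero of the Riemann zeta function. -/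

import Mathlib

open Polynomial Filter
open scoped Nat Topology

noncomputable section

namespace HermiteZeta

/-! ### Even Hermite functions and the functions `ψ^±_ℓ` -/

/-- The normalized even Hermite function `h_{2n}` (for the Fourier transform with kernel
`exp (-2πixy)`):
`h_{2n}(x) = ∑_{k=0}^n (-1)^(n-k) 2^(-n+3k+1/4) √(2n)! / ((2k)! (n-k)!) π^k x^(2k) exp (-πx²)`. -/
def hermiteEven (n : ℕ) (x : ℝ) : ℝ :=
  ∑ k ∈ Finset.range (n + 1),
    (-1 : ℝ) ^ (n - k) * (2 : ℝ) ^ (-(n : ℝ) + 3 * k + 1 / 4) *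
      (√((2 * n)! : ℝ) / ((2 * k)! * (n - k)!)) *
        (Real.pi ^ k * x ^ (2 * k) * Real.exp (-Real.pi * x ^ 2))

/-- `ψ⁺_ℓ = h_{4ℓ} - (h_{4ℓ}(0) / h_0(0)) h_0`. -/
def psiPlus (l : ℕ) (x : ℝ) : ℝ :=
  hermiteEven (2 * l) x - hermiteEven (2 * l) 0 / hermiteEven 0 0 * hermiteEven 0 x

/-- `ψ⁻_ℓ = -h_{4ℓ+2} + (h_{4ℓ+2}(0) / h_2(0)) h_2`. -/
def psiMinus (l : ℕ) (x : ℝ) : ℝ :=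
  -hermiteEven (2 * l + 1) x + hermiteEven (2 * l + 1) 0 / hermiteEven 1 0 * hermiteEven 1 x

/-! ### The map `E` and the multiplicative Fourier transform -/

/-- `E(f)(u) = u^{1/2} ∑_{n ≥ 1} f(nu)` for `u > 0`. -/
def mapE (f : ℝ → ℝ) (u : ℝ) : ℝ :=
  √u * ∑' n : ℕ, f (((n : ℝ) + 1) * u)

/-- `F_μ(f)(s) = ∫_0^∞ f(u) u^{-is} du/u`, the Mellin transform of `f` at the point `-is`. -/
def fourierMu (f : ℝ → ℝ) (s : ℂ) : ℂ :=
  mellin (fun u : ℝ => (f u : ℂ)) (-(Complex.I * s))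

/-- Absolute convergence of the integral that defines `F_μ(f)(s)`. -/
def FourierMuConvergent (f : ℝ → ℝ) (s : ℂ) : Prop :=
  MellinConvergent (fun u : ℝ => (f u : ℂ)) (-(Complex.I * s))

/-! ### The polynomials -/

/-- The polynomial `∏_{j=0}^{k-1} (j - i s / 2 + 1 / 4)` in the variable `s`. -/
def risingPoly (k : ℕ) : ℂ[X] :=
  ∏ j ∈ Finset.range k, (C ((j : ℂ) + 1 / 4) - C (Complex.I / 2) * X)

/-- `𝒫_m(s) = √(2m)! ∑_{k=0}^m (-1)^k 2^(3k-m) ∏_{j<k} (j - is/2 + 1/4) / ((2k)! (m-k)!)`. -/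
def calP (m : ℕ) : ℂ[X] :=
  C ((√((2 * m)! : ℝ) : ℝ) : ℂ) *
    ∑ k ∈ Finset.range (m + 1),
      C ((((-1 : ℝ) ^ k * (2 : ℝ) ^ (3 * (k : ℝ) - m) / ((2 * k)! * (m - k)!) : ℝ) : ℂ)) *
        risingPoly k

/-- `P⁺_ℓ(s) = ∑_{k=1}^{2ℓ} (-1)^k 2^(-2ℓ+3k-3/4) √(4ℓ)! / ((2ℓ-k)! (2k)!) ∏_{j<k} (j-is/2+1/4)`. -/
def PPlus (l : ℕ) : ℂ[X] :=
  ∑ k ∈ Finset.Icc 1 (2 * l),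
    C ((((-1 : ℝ) ^ k * (2 : ℝ) ^ (-2 * (l : ℝ) + 3 * k - 3 / 4) *
      (√((4 * l)! : ℝ) / ((2 * l - k)! * (2 * k)!)) : ℝ) : ℂ)) * risingPoly k

/-- `P⁻_ℓ(s) = -ℓ 2^(-2ℓ+5/4) √(4ℓ+2)! / (2ℓ+1)! (-is/2+1/4)
  + ∑_{k=2}^{2ℓ+1} (-1)^k 2^(3k-2ℓ-7/4) √(4ℓ+2)! / ((2ℓ+1-k)! (2k)!) ∏_{j<k} (j-is/2+1/4)`. -/
def PMinus (l : ℕ) : ℂ[X] :=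
  C (((-((l : ℝ) * (2 : ℝ) ^ (-2 * (l : ℝ) + 5 / 4) * √((4 * l + 2)! : ℝ) / (2 * l + 1)!) : ℝ) : ℂ))
      * (C (1 / 4) - C (Complex.I / 2) * X)
    + ∑ k ∈ Finset.Icc 2 (2 * l + 1),
      C ((((-1 : ℝ) ^ k * (2 : ℝ) ^ (3 * (k : ℝ) - 2 * l - 7 / 4) *
        (√((4 * l + 2)! : ℝ) / ((2 * l + 1 - k)! * (2 * k)!)) : ℝ) : ℂ)) * risingPoly k

/-- `R⁺_ℓ`, the quotient of `-2 P⁺_ℓ` by `s² + 1/4`, so that `P⁺_ℓ = -(1/2)(1/4 + s²) R⁺_ℓ`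
(that the division is exact is part of the theorem). -/
def RPlus (l : ℕ) : ℂ[X] := (C (-2) * PPlus l) /ₘ (X ^ 2 + C (1 / 4))

/-- `R⁻_ℓ`, the quotient of `-2 P⁻_ℓ` by `s² + 1/4`, so that `P⁻_ℓ = -(1/2)(1/4 + s²) R⁻_ℓ`
(that the division is exact is part of the theorem). -/
def RMinus (l : ℕ) : ℂ[X] := (C (-2) * PMinus l) /ₘ (X ^ 2 + C (1 / 4))

/-! ### The Riemann-Landau `Ξ` function -/

/-- The entire function `Ξ(s) = (z(z-1)/2) Γ(z/2) π^(-z/2) ζ(z)`, `z = 1/2 + is`. With `Λ₀` the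
entire function such that `Γ(z/2) π^(-z/2) ζ(z) = Λ₀(z) - 1/z - 1/(1-z)`, it is
`z(z-1)/2 Λ₀(z) + 1/2`; this form carries no junk value at the removable singularities
(see `Xi_eq` and `differentiable_Xi`). -/
def Xi (s : ℂ) : ℂ :=
  (1 / 2 + Complex.I * s) * ((1 / 2 + Complex.I * s) - 1) / 2 *
    completedRiemannZeta₀ (1 / 2 + Complex.I * s) + 1 / 2

theorem differentiable_Xi : Differentiable ℂ Xi := by
  unfold Xi
  have h : Differentiable ℂ fun s : ℂ => completedRiemannZeta₀ (1 / 2 + Complex.I * s) :=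
    differentiable_completedZeta₀.comp (by fun_prop)
  fun_prop

theorem Xi_eq (s z : ℂ) (hz : z = 1 / 2 + Complex.I * s) (h1 : z ≠ 1)
    (hpole : ∀ n : ℕ, z ≠ -(2 * n)) :
    Xi s = z * (z - 1) / 2 * Complex.Gamma (z / 2) * (Real.pi : ℂ) ^ (-z / 2) * riemannZeta z := by
  have h0 : z ≠ 0 := by simpa using hpole 0
  have hG : Complex.Gammaℝ z ≠ 0 := by
    rw [Ne, Complex.Gammaℝ_eq_zero_iff]
    rintro ⟨n, hn⟩
    exact hpole n hn
  have key : Complex.Gamma (z / 2) * (Real.pi : ℂ) ^ (-z / 2) * riemannZeta z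
      = completedRiemannZeta z := by
    rw [riemannZeta_def_of_ne_zero h0, mul_comm (Complex.Gamma _), ← Complex.Gammaℝ_def]
    field_simp
  have h1' : 1 - z ≠ 0 := sub_ne_zero.mpr (Ne.symm h1)
  rw [mul_assoc, mul_assoc, ← mul_assoc (Complex.Gamma _), key, completedRiemannZeta_eq, Xi, ← hz]
  field_simp
  ring

/-- Nontrivial zeros of the Riemann zeta function. -/
def IsNontrivialZetaZero (z : ℂ) : Prop :=
  riemannZeta z = 0 ∧ z ≠ 1 ∧ ¬∃ n : ℕ, z = -2 * (n + 1)

/-! ### The topological ring of entire functions of order at most one -/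

/-- Auxiliary growth bound: `2 r^(1+ε/2) ≤ K + r^(1+ε)`. -/
theorem exists_two_mul_rpow_le {ε : ℝ} (hε : 0 < ε) :
    ∃ K : ℝ, ∀ r : ℝ, 0 ≤ r → 2 * r ^ (1 + ε / 2) ≤ K + r ^ (1 + ε) := by
  refine ⟨2 * ((2 : ℝ) ^ (2 / ε)) ^ (1 + ε / 2), fun r hr => ?_⟩
  set M : ℝ := (2 : ℝ) ^ (2 / ε) with hM
  have hM0 : 0 < M := by positivity
  rcases le_total r M with h | h
  · have h1 : r ^ (1 + ε / 2) ≤ M ^ (1 + ε / 2) := Real.rpow_le_rpow hr h (by positivity)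
    have h2 : 0 ≤ r ^ (1 + ε) := by positivity
    linarith
  · have hr0 : 0 < r := hM0.trans_le h
    have h1 : (2 : ℝ) ≤ r ^ (ε / 2) := by
      calc (2 : ℝ) = M ^ (ε / 2) := by
            rw [hM, ← Real.rpow_mul (by norm_num)]
            have : 2 / ε * (ε / 2) = 1 := by field_simp
            rw [this, Real.rpow_one]
        _ ≤ r ^ (ε / 2) := Real.rpow_le_rpow hM0.le h (by positivity)
    have h2 : r ^ (1 + ε) = r ^ (ε / 2) * r ^ (1 + ε / 2) := by
      rw [← Real.rpow_add hr0]
      congr 1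
      ring
    have h3 : 0 ≤ r ^ (1 + ε / 2) := by positivity
    have h4 : 0 ≤ 2 * M ^ (1 + ε / 2) := by positivity
    rw [h2]
    nlinarith

/-- Entire functions of order at most `1`: entire functions `f` such that, for every `ε > 0`,
`f(z) = O(exp(|z|^(1+ε)))`. -/
def entireOrderLEOne : Subalgebra ℂ (ℂ → ℂ) where
  carrier := {f | Differentiable ℂ f ∧
    ∀ ε : ℝ, 0 < ε → ∃ A : ℝ, ∀ z : ℂ, ‖f z‖ ≤ A * Real.exp (‖z‖ ^ (1 + ε))}
  add_mem' := by
    rintro f g ⟨hf, hf'⟩ ⟨hg, hg'⟩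
    refine ⟨hf.add hg, fun ε hε => ?_⟩
    obtain ⟨A, hA⟩ := hf' ε hε
    obtain ⟨B, hB⟩ := hg' ε hε
    refine ⟨A + B, fun z => ?_⟩
    rw [add_mul]
    exact (norm_add_le _ _).trans (add_le_add (hA z) (hB z))
  mul_mem' := by
    rintro f g ⟨hf, hf'⟩ ⟨hg, hg'⟩
    refine ⟨hf.mul hg, fun ε hε => ?_⟩
    obtain ⟨A, hA⟩ := hf' (ε / 2) (by positivity)
    obtain ⟨B, hB⟩ := hg' (ε / 2) (by positivity)
    obtain ⟨K, hK⟩ := exists_two_mul_rpow_le hε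
    have hA0 : 0 ≤ A :=
      nonneg_of_mul_nonneg_left ((norm_nonneg _).trans (hA 0)) (Real.exp_pos _)
    have hB0 : 0 ≤ B :=
      nonneg_of_mul_nonneg_left ((norm_nonneg _).trans (hB 0)) (Real.exp_pos _)
    refine ⟨A * B * Real.exp K, fun z => ?_⟩
    calc ‖(f * g) z‖ = ‖f z‖ * ‖g z‖ := by simp
      _ ≤ (A * Real.exp (‖z‖ ^ (1 + ε / 2))) * (B * Real.exp (‖z‖ ^ (1 + ε / 2))) :=
          mul_le_mul (hA z) (hB z) (norm_nonneg _) (by positivity)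
      _ = A * B * Real.exp (2 * ‖z‖ ^ (1 + ε / 2)) := by rw [two_mul, Real.exp_add]; ring
      _ ≤ A * B * Real.exp (K + ‖z‖ ^ (1 + ε)) := by
          gcongr
          exact hK _ (norm_nonneg z)
      _ = A * B * Real.exp K * Real.exp (‖z‖ ^ (1 + ε)) := by rw [Real.exp_add]; ring
  algebraMap_mem' := by
    intro c
    refine ⟨differentiable_const c, fun ε _ => ⟨‖c‖, fun z => ?_⟩⟩
    exact le_mul_of_one_le_right (norm_nonneg c) (Real.one_le_exp (by positivity))

/-- The ring `H_{≤1}`. -/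
def HadamardRing : Type := entireOrderLEOne

namespace HadamardRing

instance : CommRing HadamardRing := inferInstanceAs (CommRing entireOrderLEOne)
instance : Algebra ℂ HadamardRing := inferInstanceAs (Algebra ℂ entireOrderLEOne)

/-- The entire function underlying an element of `H_{≤1}`. -/
def toFun (f : HadamardRing) : ℂ → ℂ := f.1

theorem bddAbove_weight (f : HadamardRing) (ε : Set.Ioi (0 : ℝ)) :
    BddAbove (Set.range fun z : ℂ => ‖f.toFun z‖ * Real.exp (-‖z‖ ^ (1 + (ε : ℝ)))) := by
  obtain ⟨A, hA⟩ := f.2.2 ε ε.2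
  refine ⟨A, ?_⟩
  rintro _ ⟨z, rfl⟩
  have := mul_le_mul_of_nonneg_right (hA z) (Real.exp_pos (-‖z‖ ^ (1 + (ε : ℝ)))).le
  rwa [mul_assoc, ← Real.exp_add, add_neg_cancel, Real.exp_zero, mul_one] at this

/-- The norms `p_ε(f) = sup_z |f(z)| exp(-|z|^(1+ε))`, `ε > 0`. -/
def growthSeminorm : SeminormFamily ℂ HadamardRing (Set.Ioi (0 : ℝ)) := fun ε =>
  Seminorm.of (fun f => ⨆ z : ℂ, ‖f.toFun z‖ * Real.exp (-‖z‖ ^ (1 + (ε : ℝ))))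
    (by
      intro f g
      refine ciSup_le fun z => ?_
      refine le_trans ?_ (add_le_add (le_ciSup (f.bddAbove_weight ε) z)
        (le_ciSup (g.bddAbove_weight ε) z))
      rw [← add_mul]
      exact mul_le_mul_of_nonneg_right (norm_add_le _ _) (Real.exp_pos _).le)
    (by
      intro c f
      rw [Real.mul_iSup_of_nonneg (norm_nonneg c)]
      refine iSup_congr fun z => ?_
      have : (c • f).toFun z = c * f.toFun z := rfl
      rw [this, norm_mul, mul_assoc])

theorem growthSeminorm_apply (ε : Set.Ioi (0 : ℝ)) (f : HadamardRing) :
    growthSeminorm ε f = ⨆ z : ℂ, ‖f.toFun z‖ * Real.exp (-‖z‖ ^ (1 + (ε : ℝ))) := rfl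

/-- The topology of `H_{≤1}`: the locally convex (Fréchet) topology defined by the norms
`p_ε`, `ε > 0`. -/
instance : TopologicalSpace HadamardRing := growthSeminorm.moduleFilterBasis.topology

theorem withSeminorms : WithSeminorms growthSeminorm := ⟨rfl⟩

instance : IsTopologicalAddGroup HadamardRing := withSeminorms.topologicalAddGroup
instance : ContinuousSMul ℂ HadamardRing := withSeminorms.continuousSMul

theorem growthSeminorm_mul_le (ε : Set.Ioi (0 : ℝ)) :
    ∃ δ : Set.Ioi (0 : ℝ), ∃ K : ℝ, 0 ≤ K ∧ ∀ f g : HadamardRing,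
      growthSeminorm ε (f * g) ≤ K * (growthSeminorm δ f * growthSeminorm δ g) := by
  obtain ⟨K, hK⟩ := exists_two_mul_rpow_le ε.2
  have hε2 : 0 < (ε : ℝ) / 2 := half_pos (Set.mem_Ioi.mp ε.2)
  refine ⟨⟨(ε : ℝ) / 2, hε2⟩, Real.exp K, (Real.exp_pos _).le, fun f g => ?_⟩
  rw [growthSeminorm_apply ε]
  refine ciSup_le fun z => ?_
  set δ : Set.Ioi (0 : ℝ) := ⟨(ε : ℝ) / 2, hε2⟩ with hδ
  have hf : ‖f.toFun z‖ * Real.exp (-‖z‖ ^ (1 + (δ : ℝ))) ≤ growthSeminorm δ f :=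
    le_ciSup (f.bddAbove_weight δ) z
  have hg : ‖g.toFun z‖ * Real.exp (-‖z‖ ^ (1 + (δ : ℝ))) ≤ growthSeminorm δ g :=
    le_ciSup (g.bddAbove_weight δ) z
  have hz : -‖z‖ ^ (1 + (ε : ℝ)) ≤ K + (-‖z‖ ^ (1 + (δ : ℝ)) + -‖z‖ ^ (1 + (δ : ℝ))) := by
    have := hK ‖z‖ (norm_nonneg z)
    change 2 * ‖z‖ ^ (1 + (δ : ℝ)) ≤ _ at this
    linarith
  have hfg : (f * g).toFun z = f.toFun z * g.toFun z := rfl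
  calc ‖(f * g).toFun z‖ * Real.exp (-‖z‖ ^ (1 + (ε : ℝ)))
      ≤ ‖f.toFun z‖ * ‖g.toFun z‖ *
        Real.exp (K + (-‖z‖ ^ (1 + (δ : ℝ)) + -‖z‖ ^ (1 + (δ : ℝ)))) := by
        rw [hfg, norm_mul]
        gcongr
    _ = Real.exp K * ((‖f.toFun z‖ * Real.exp (-‖z‖ ^ (1 + (δ : ℝ)))) *
        (‖g.toFun z‖ * Real.exp (-‖z‖ ^ (1 + (δ : ℝ))))) := by
        rw [Real.exp_add, Real.exp_add]; ring
    _ ≤ Real.exp K * (growthSeminorm δ f * growthSeminorm δ g) := by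
        refine mul_le_mul_of_nonneg_left ?_ (Real.exp_pos _).le
        exact mul_le_mul hf hg (by positivity) (apply_nonneg _ _)

instance : IsTopologicalRing HadamardRing := by
  have h0 : ∀ δ, Tendsto (fun f => growthSeminorm δ f) (𝓝 (0 : HadamardRing)) (𝓝 0) := by
    intro δ
    have h := (withSeminorms.continuous_seminorm δ).tendsto 0
    rwa [map_zero] at h
  have aux : ∀ {α : Type} (F : Filter α) (u : α → HadamardRing),
      (∀ ε, Tendsto (fun a => growthSeminorm ε (u a)) F (𝓝 0)) → Tendsto u F (𝓝 0) := by
    intro α F u h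
    rw [withSeminorms.tendsto_nhds]
    intro ε r hr
    filter_upwards [(h ε).eventually (gt_mem_nhds hr)] with a ha
    rwa [sub_zero]
  refine IsTopologicalRing.of_addGroup_of_nhds_zero ?_ ?_ ?_
  · refine aux _ _ fun ε => ?_
    obtain ⟨δ, K, -, hK⟩ := growthSeminorm_mul_le ε
    refine squeeze_zero (fun _ => apply_nonneg _ _) (fun p => hK p.1 p.2) ?_
    have h1 : Tendsto (fun p : HadamardRing × HadamardRing => growthSeminorm δ p.1)
        (𝓝 0 ×ˢ 𝓝 0) (𝓝 0) := (h0 δ).comp tendsto_fst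
    have h2 : Tendsto (fun p : HadamardRing × HadamardRing => growthSeminorm δ p.2)
        (𝓝 0 ×ˢ 𝓝 0) (𝓝 0) := (h0 δ).comp tendsto_snd
    simpa using (h1.mul h2).const_mul K
  · intro f
    refine aux _ _ fun ε => ?_
    obtain ⟨δ, K, -, hK⟩ := growthSeminorm_mul_le ε
    refine squeeze_zero (fun _ => apply_nonneg _ _) (fun p => hK f p) ?_
    simpa using ((h0 δ).const_mul (growthSeminorm δ f)).const_mul K
  · intro f
    refine aux _ _ fun ε => ?_
    obtain ⟨δ, K, -, hK⟩ := growthSeminorm_mul_le ε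
    refine squeeze_zero (fun _ => apply_nonneg _ _) (fun p => hK p f) ?_
    simpa using ((h0 δ).mul_const (growthSeminorm δ f)).const_mul K

/-- The coordinate function `s`, as an element of `H_{≤1}`. -/
def coord : HadamardRing :=
  ⟨fun s => s, differentiable_id, fun ε hε => ⟨1, fun z => by
    rw [one_mul]
    rcases le_total ‖z‖ 1 with h | h
    · exact h.trans (Real.one_le_exp (by positivity))
    · calc ‖z‖ = ‖z‖ ^ (1 : ℝ) := (Real.rpow_one _).symm
        _ ≤ ‖z‖ ^ (1 + ε) := Real.rpow_le_rpow_of_exponent_le h (by linarith)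
        _ ≤ ‖z‖ ^ (1 + ε) + 1 := by linarith
        _ ≤ Real.exp (‖z‖ ^ (1 + ε)) := Real.add_one_le_exp _⟩⟩

/-- The continuous operator `f(s) ↦ s f(s)` of multiplication by `s` in `H_{≤1}`. -/
def mulS : HadamardRing →L[ℂ] HadamardRing where
  toLinearMap := LinearMap.mulLeft ℂ coord
  cont := continuous_const.mul continuous_id

/-- The continuous operator induced by multiplication by `s` on the quotient `H_{≤1} ⧸ V` by a
subspace `V` that is stable under multiplication by `s`: the class of `f` goes to the class of
`s f`. -/
def quotientMulS (V : Submodule ℂ HadamardRing) (hV : ∀ f ∈ V, mulS f ∈ V) :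
    (HadamardRing ⧸ V) →L[ℂ] (HadamardRing ⧸ V) :=
  V.liftQL (V.mkQL ∘L mulS) fun f hf => by
    simpa using hV f hf

theorem quotientMulS_mk (V : Submodule ℂ HadamardRing) (hV : ∀ f ∈ V, mulS f ∈ V)
    (f : HadamardRing) :
    quotientMulS V hV (Submodule.Quotient.mk f) = Submodule.Quotient.mk (coord * f) := rfl

end HadamardRing

/-- The closure in `H_{≤1}` of the linear span of the functions `F_μ(E(ψ^±_ℓ))`, `ℓ ≥ 0`. -/
def closedSpan : Submodule ℂ HadamardRing :=
  (Submodule.span ℂ {f : HadamardRing | ∃ l : ℕ,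
    f.toFun = fourierMu (mapE (psiPlus l)) ∨
      f.toFun = fourierMu (mapE (psiMinus l))}).topologicalClosure

end HermiteZeta

end

open HermiteZeta

noncomputable section

open Asymptotics MeasureTheory
open scoped FourierTransform SchwartzMap

namespace HermiteZeta

/-! Put `w = 1/2 - is`, so that `a = w/2`. The Mellin transform of `x^(2k) exp(-πx²)` at `w` is
`Γ_ℝ(w + 2k)/2`, which the functional equation of `Γ_ℝ` turns into `π^(-k) Γ_ℝ(w) (a)_k / 2`. Hence
`h_{2n}` has transform `2^(-3/4) (-1)^n Γ_ℝ(w) 𝒫_n(s)`, and `ψ^±_ℓ` has transform `Γ_ℝ(w) P^±_ℓ(s)`.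
The value of `𝒫_n` at `-i/2` carries `h_{2n}(0)`, the value at `i/2` carries the integral of
`h_{2n}`, and by the binomial theorem the two differ by the sign `(-1)^n`. So the correction that
kills `ψ(0)` also kills `∫ψ`, and `P^±_ℓ` vanishes at both `±i/2`.

Applying `E` multiplies the transform by `ζ(w)` where `Re w > 1` (`mellin_mapEC`). Since `ψ(0) = ∫ψ
= 0`, Poisson summation makes `E(ψ)(u)` vanish to infinite order as `u → 0`
(`norm_dilateSum_le_pow`), so its transform is entire and the identity theorem extends the formula
`R Ξ` to all `s` (`IsZetaPair.mellin_mapEC_eq`).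

Among the `R^±_ℓ` there is one of each degree, so they span `ℂ[s]`, and `V` is the closure of `ℂ[s]
Ξ` (`closedSpan_eq`). That `Ξ` itself lies in `H_{≤1}` is read off the Mellin integral
(`exists_norm_Xi_le`).

For any `Z` in `H_{≤1}`, multiplication by `s` modulo the closure of `ℂ[s] Z` has the zero set of
`Z` as spectrum (`HadamardRing.spectrum_quotientMulS`). If `Z(a) ≠ 0`, subtracting a multiple of `Z`
makes `f` divisible by `s - a`, and this division is continuous. If `Z(a) = 0`, evaluation at `a`
kills the closed span but not `1`. It remains to identify the zeros of `Ξ`. -/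

/-! ### The polynomials `(a)_k`, `𝒫_m` and `P^±_ℓ`. -/

theorem natDegree_risingFactor (j : ℕ) :
    (C ((j : ℂ) + 1 / 4) - C (Complex.I / 2) * X : ℂ[X]).natDegree = 1 := by
  have : (C ((j : ℂ) + 1 / 4) - C (Complex.I / 2) * X : ℂ[X])
      = C (-(Complex.I / 2)) * X + C ((j : ℂ) + 1 / 4) := by
    rw [C_neg]; ring
  rw [this]
  exact natDegree_linear (by simp)

theorem natDegree_risingPoly (k : ℕ) : (risingPoly k).natDegree = k := by
  unfold risingPoly
  rw [natDegree_prod]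
  · rw [Finset.sum_congr rfl fun j _ => natDegree_risingFactor j]
    simp
  · intro j _ h
    have := natDegree_risingFactor j
    rw [h] at this
    simp at this

theorem risingPoly_ne_zero (k : ℕ) : risingPoly k ≠ 0 := by
  unfold risingPoly
  refine Finset.prod_ne_zero_iff.mpr fun j _ h => ?_
  have := natDegree_risingFactor j
  rw [h] at this
  simp at this

theorem degree_risingPoly (k : ℕ) : (risingPoly k).degree = k := by
  rw [degree_eq_natDegree (risingPoly_ne_zero k), natDegree_risingPoly]

/-- At `s = i/2` one has `a = 1/2`. -/
theorem eval_risingPoly_I_div_two (k : ℕ) :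
    (risingPoly k).eval (Complex.I / 2) = ((2 * k)! : ℂ) / (4 ^ k * (k ! : ℂ)) := by
  induction k with
  | zero => simp [risingPoly]
  | succ k ih =>
    have hk : ((k : ℂ) + 1) ≠ 0 := by exact_mod_cast k.succ_ne_zero
    have hk' : ((k ! : ℕ) : ℂ) ≠ 0 := by exact_mod_cast k.factorial_ne_zero
    rw [risingPoly, Finset.prod_range_succ, eval_mul]
    change (risingPoly k).eval _ * _ = _
    rw [ih, show 2 * (k + 1) = 2 * k + 1 + 1 by ring, Nat.factorial_succ, Nat.factorial_succ,
      Nat.factorial_succ]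
    have hI : Complex.I / 2 * (Complex.I / 2) = -(1 / 4) := by
      have := Complex.I_mul_I
      linear_combination this / 4
    simp only [eval_sub, eval_mul, eval_C, eval_X, hI]
    push_cast
    field_simp
    ring

/-- At `s = -i/2` one has `a = 0`, so evaluation there extracts the `k = 0` term. -/
theorem eval_risingPoly_neg_I_div_two (k : ℕ) :
    (risingPoly k).eval (-(Complex.I / 2)) = if k = 0 then 1 else 0 := by
  rcases k with _ | k
  · simp [risingPoly]
  · rw [risingPoly, Finset.prod_range_succ', eval_mul]
    have hI : Complex.I / 2 * -(Complex.I / 2) = 1 / 4 := by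
      have := Complex.I_mul_I
      linear_combination -this / 4
    simp [hI]

/-- The coefficient of `(a)_k` in `𝒫_m`, without the factor `√(2m)!`. -/
def calPCoeff (m k : ℕ) : ℝ :=
  (-1 : ℝ) ^ k * (2 : ℝ) ^ (3 * (k : ℝ) - m) / ((2 * k)! * (m - k)!)

theorem calPCoeff_ne_zero (m k : ℕ) : calPCoeff m k ≠ 0 := by
  unfold calPCoeff
  have : (2 : ℝ) ^ (3 * (k : ℝ) - m) ≠ 0 := by positivity
  have h1 : ((2 * k)! : ℝ) ≠ 0 := by positivity
  have h2 : ((m - k)! : ℝ) ≠ 0 := by positivity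
  have h3 : (-1 : ℝ) ^ k ≠ 0 := by simp
  positivity

theorem calP_eq (m : ℕ) : calP m = C ((√((2 * m)! : ℝ) : ℝ) : ℂ) *
    ∑ k ∈ Finset.range (m + 1), C ((calPCoeff m k : ℝ) : ℂ) * risingPoly k := rfl

theorem two_rpow_three_mul_sub (m k : ℕ) :
    (2 : ℝ) ^ (3 * (k : ℝ) - m) = 8 ^ k / 2 ^ m := by
  rw [Real.rpow_sub (by norm_num), Real.rpow_natCast, Real.rpow_mul (by norm_num)]
  norm_num

theorem eval_calP_neg_I_div_two (m : ℕ) :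
    (calP m).eval (-(Complex.I / 2)) = ((√((2 * m)! : ℝ) * (1 / (2 ^ m * m !)) : ℝ) : ℂ) := by
  rw [calP_eq, eval_mul, eval_C, eval_finsetSum, Finset.sum_range_succ']
  simp only [eval_mul, eval_C, eval_risingPoly_neg_I_div_two]
  have : calPCoeff m 0 = 1 / (2 ^ m * m !) := by
    simp only [calPCoeff, two_rpow_three_mul_sub]
    simp only [pow_zero, mul_zero, Nat.factorial_zero, Nat.sub_zero, Nat.cast_one]
    field_simp
  simp [this]

/-- The factor `(2k)!` of `(1/2)_k` cancels the one in the denominator, leaving the binomial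
expansion of `(1 - 2)^m`. Up to the sign `(-1)^m` this is the value at `-i/2`. -/
theorem eval_calP_I_div_two (m : ℕ) :
    (calP m).eval (Complex.I / 2)
      = (-1) ^ m * ((√((2 * m)! : ℝ) * (1 / (2 ^ m * m !)) : ℝ) : ℂ) := by
  rw [calP_eq, eval_mul, eval_C, eval_finsetSum]
  have hsum : ∑ k ∈ Finset.range (m + 1),
      (C ((calPCoeff m k : ℝ) : ℂ) * risingPoly k).eval (Complex.I / 2)
      = ∑ k ∈ Finset.range (m + 1), (((-2 : ℂ)) ^ k * 1 ^ (m - k) * (m.choose k : ℂ))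
          * (1 / (2 ^ m * m !)) := by
    refine Finset.sum_congr rfl fun k hk => ?_
    have hkm : k ≤ m := Nat.lt_succ_iff.mp (Finset.mem_range.mp hk)
    rw [eval_mul, eval_C, eval_risingPoly_I_div_two, Nat.cast_choose ℂ hkm, calPCoeff,
      two_rpow_three_mul_sub]
    have h1 : ((2 * k)! : ℂ) ≠ 0 := by exact_mod_cast Nat.factorial_ne_zero _
    have h2 : ((m - k)! : ℂ) ≠ 0 := by exact_mod_cast Nat.factorial_ne_zero _
    have h3 : (k ! : ℂ) ≠ 0 := by exact_mod_cast Nat.factorial_ne_zero _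
    have h4 : (m ! : ℂ) ≠ 0 := by exact_mod_cast Nat.factorial_ne_zero _
    push_cast
    rw [show (-2 : ℂ) = -1 * 2 by norm_num, show (8 : ℂ) = 4 * 2 by norm_num, mul_pow, mul_pow]
    field_simp
    simp
  rw [hsum, ← Finset.sum_mul, ← add_pow]
  push_cast
  norm_num
  ring

theorem calP_eq_eval_add (m : ℕ) : calP m = C ((calP m).eval (-(Complex.I / 2))) +
    C ((√((2 * m)! : ℝ) : ℝ) : ℂ) *
      ∑ k ∈ Finset.Icc 1 m, C ((calPCoeff m k : ℝ) : ℂ) * risingPoly k := by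
  conv_lhs => rw [calP_eq, Finset.range_eq_Ico, Finset.sum_eq_sum_Ico_succ_bot (by lia), mul_add]
  congr 1
  rw [calP_eq, eval_mul, eval_C, eval_finsetSum, Finset.sum_range_succ']
  simp only [eval_mul, eval_C, eval_risingPoly_neg_I_div_two]
  simp [risingPoly]

theorem PPlus_eq (l : ℕ) :
    PPlus l = C (((2 : ℝ) ^ (-(3 / 4) : ℝ) : ℝ) : ℂ) *
      (calP (2 * l) - C ((calP (2 * l)).eval (Complex.I / 2))) := by
  have he : (calP (2 * l)).eval (Complex.I / 2) = (calP (2 * l)).eval (-(Complex.I / 2)) := by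
    rw [eval_calP_I_div_two, eval_calP_neg_I_div_two, pow_mul]
    simp
  rw [he]
  conv_rhs => rw [calP_eq_eval_add (2 * l)]
  simp only [eval_add, eval_C, eval_mul, eval_finsetSum]
  have h0 : ∑ k ∈ Finset.Icc 1 (2 * l), ((calPCoeff (2 * l) k : ℝ) : ℂ) *
      (risingPoly k).eval (-(Complex.I / 2)) = 0 := by
    refine Finset.sum_eq_zero fun k hk => ?_
    rw [eval_risingPoly_neg_I_div_two, if_neg (by have := Finset.mem_Icc.mp hk; lia), mul_zero]
  rw [h0, mul_zero, add_zero, add_sub_cancel_left, Finset.mul_sum, Finset.mul_sum, PPlus]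
  refine Finset.sum_congr rfl fun k _ => ?_
  rw [← mul_assoc, ← mul_assoc, ← C_mul, ← C_mul]
  congr 2
  rw [calPCoeff]
  have h2 : (2 : ℝ) ^ (-2 * (l : ℝ) + 3 * k - 3 / 4)
      = (2 : ℝ) ^ (-(3 / 4) : ℝ) * (2 : ℝ) ^ (3 * (k : ℝ) - (2 * l : ℕ)) := by
    rw [← Real.rpow_add (by norm_num)]
    congr 1
    push_cast
    ring
  rw [h2, show 2 * (2 * l) = 4 * l by ring]
  push_cast
  ring

theorem eval_calP_odd (l : ℕ) : (calP (2 * l + 1)).eval (Complex.I / 2)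
    = -(calP (2 * l + 1)).eval (-(Complex.I / 2)) := by
  rw [eval_calP_I_div_two, eval_calP_neg_I_div_two, pow_succ, pow_mul]
  simp

/-- With `c = 𝒫_{2ℓ+1}(-i/2)`, the constant term and the linear correction combine to `c - 2ics = 4c
a`, a multiple of `(a)_1`. -/
theorem PMinus_eq (l : ℕ) :
    PMinus l = C (((2 : ℝ) ^ (-(3 / 4) : ℝ) : ℝ) : ℂ) *
      (calP (2 * l + 1) + C (2 * Complex.I * (calP (2 * l + 1)).eval (Complex.I / 2)) * X) := by
  rw [eval_calP_odd]
  conv_rhs => rw [calP_eq_eval_add (2 * l + 1)]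
  simp only [eval_add, eval_C, eval_mul, eval_finsetSum]
  have h0 : ∑ k ∈ Finset.Icc 1 (2 * l + 1), ((calPCoeff (2 * l + 1) k : ℝ) : ℂ) *
      (risingPoly k).eval (-(Complex.I / 2)) = 0 := by
    refine Finset.sum_eq_zero fun k hk => ?_
    rw [eval_risingPoly_neg_I_div_two, if_neg (by have := Finset.mem_Icc.mp hk; lia), mul_zero]
  have hsplit : ∑ k ∈ Finset.Icc 1 (2 * l + 1), C ((calPCoeff (2 * l + 1) k : ℝ) : ℂ) * risingPoly k
      = C ((calPCoeff (2 * l + 1) 1 : ℝ) : ℂ) * (C (1 / 4) - C (Complex.I / 2) * X) +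
        ∑ k ∈ Finset.Icc 2 (2 * l + 1), C ((calPCoeff (2 * l + 1) k : ℝ) : ℂ) * risingPoly k := by
    rw [← Finset.add_sum_Ioc_eq_sum_Icc (by lia : 1 ≤ 2 * l + 1)]
    congr 1
    simp [risingPoly]
  have hsum : ∑ k ∈ Finset.Icc 2 (2 * l + 1),
      C ((((-1 : ℝ) ^ k * (2 : ℝ) ^ (3 * (k : ℝ) - 2 * l - 7 / 4) *
        (√((4 * l + 2)! : ℝ) / ((2 * l + 1 - k)! * (2 * k)!)) : ℝ) : ℂ)) * risingPoly k
      = C (((2 : ℝ) ^ (-(3 / 4) : ℝ) : ℝ) : ℂ) * (C ((√((4 * l + 2)! : ℝ) : ℝ) : ℂ) *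
        ∑ k ∈ Finset.Icc 2 (2 * l + 1), C ((calPCoeff (2 * l + 1) k : ℝ) : ℂ) * risingPoly k) := by
    rw [Finset.mul_sum, Finset.mul_sum]
    refine Finset.sum_congr rfl fun k _ => ?_
    rw [← mul_assoc, ← mul_assoc, ← C_mul, ← C_mul]
    congr 2
    rw [calPCoeff]
    have h2 : (2 : ℝ) ^ (3 * (k : ℝ) - 2 * l - 7 / 4)
        = (2 : ℝ) ^ (-(3 / 4) : ℝ) * (2 : ℝ) ^ (3 * (k : ℝ) - (2 * l + 1 : ℕ)) := by
      rw [← Real.rpow_add (by norm_num)]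
      congr 1
      push_cast
      ring
    rw [h2]
    push_cast
    ring
  rw [h0, mul_zero, add_zero, hsplit, PMinus, hsum, eval_calP_neg_I_div_two,
    show 2 * (2 * l + 1) = 4 * l + 2 by ring]
  set S := ∑ k ∈ Finset.Icc 2 (2 * l + 1), C ((calPCoeff (2 * l + 1) k : ℝ) : ℂ) * risingPoly k
  set r := √((4 * l + 2)! : ℝ)
  set d := (2 : ℝ) ^ (-(3 / 4) : ℝ) with hd
  -- The total coefficient of `a`: `4c` from the correction plus the `k = 1` coefficient of
  -- `𝒫_{2ℓ+1}`.
  have hreal : -((l : ℝ) * (2 : ℝ) ^ (-2 * (l : ℝ) + 5 / 4) * r / (2 * l + 1)!)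
      = d * (4 * (r * (1 / (2 ^ (2 * l + 1) * (2 * l + 1)!))) + r * calPCoeff (2 * l + 1) 1) := by
    have h2 : (2 : ℝ) ^ (-2 * (l : ℝ) + 5 / 4) = d * (4 / 2 ^ (2 * l)) := by
      rw [show -2 * (l : ℝ) + 5 / 4 = -(3 / 4) + (2 - (2 * l : ℕ)) by push_cast; ring,
        Real.rpow_add (by norm_num), Real.rpow_sub (by norm_num), Real.rpow_natCast]
      norm_num [hd]
    have hf : ((2 * l + 1)! : ℝ) = (2 * l + 1) * (2 * l)! := by
      rw [Nat.factorial_succ]; push_cast; ring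
    have hf0 : ((2 * l)! : ℝ) ≠ 0 := by positivity
    rw [h2, calPCoeff, two_rpow_three_mul_sub, Nat.add_sub_cancel, hf, pow_succ]
    have hl : (2 * (l : ℝ) + 1) ≠ 0 := by positivity
    norm_num [Nat.factorial]
    field_simp
    ring
  rw [hreal]
  have h4 : (C 4 : ℂ[X]) * C (1 / 4) = 1 := by rw [← C_mul]; norm_num
  have h5 : (C 4 : ℂ[X]) * C (Complex.I / 2) = C (2 * Complex.I) := by
    rw [← C_mul]; congr 1; ring
  push_cast
  simp only [C_mul, C_add, C_neg] at h5 ⊢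
  linear_combination (C ((d : ℝ) : ℂ) * C (r : ℂ) *
    C (1 / (2 ^ (2 * l + 1) * ((2 * l + 1)! : ℂ)))) * h4 -
    (C ((d : ℝ) : ℂ) * C (r : ℂ) * C (1 / (2 ^ (2 * l + 1) * ((2 * l + 1)! : ℂ)))) * X * h5

/-! ### Divisibility by `1/4 + s²`, and the span of the `R^±_ℓ`. -/

theorem monic_X_sq_add_C : (X ^ 2 + C (1 / 4) : ℂ[X]).Monic :=
  monic_X_pow_add_C _ two_ne_zero

theorem X_sq_add_C_dvd {P : ℂ[X]} (h1 : P.eval (Complex.I / 2) = 0)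
    (h2 : P.eval (-(Complex.I / 2)) = 0) : X ^ 2 + C (1 / 4) ∣ P := by
  have hfac : (X ^ 2 + C (1 / 4) : ℂ[X]) = (X - C (Complex.I / 2)) * (X - C (-(Complex.I / 2))) := by
    have : (C (Complex.I / 2) * C (Complex.I / 2) : ℂ[X]) = -C (1 / 4) := by
      rw [← C_mul, ← C_neg]
      congr 1
      linear_combination Complex.I_mul_I / 4
    rw [C_neg]
    linear_combination this
  rw [hfac]
  refine IsCoprime.mul_dvd (isCoprime_X_sub_C_of_isUnit_sub ?_) (dvd_iff_isRoot.mpr h1)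
    (dvd_iff_isRoot.mpr h2)
  simp

theorem X_sq_add_C_dvd_PPlus (l : ℕ) : X ^ 2 + C (1 / 4) ∣ PPlus l := by
  have he : (calP (2 * l)).eval (Complex.I / 2) = (calP (2 * l)).eval (-(Complex.I / 2)) := by
    rw [eval_calP_I_div_two, eval_calP_neg_I_div_two, pow_mul]
    simp
  refine X_sq_add_C_dvd ?_ ?_ <;> rw [PPlus_eq]
  · simp
  · simp [he]

theorem X_sq_add_C_dvd_PMinus (l : ℕ) : X ^ 2 + C (1 / 4) ∣ PMinus l := by
  refine X_sq_add_C_dvd ?_ ?_ <;> rw [PMinus_eq, eval_mul]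
  · simp only [eval_add, eval_mul, eval_C, eval_X]
    rw [mul_eq_zero]
    right
    linear_combination (calP (2 * l + 1)).eval (Complex.I / 2) * Complex.I_mul_I
  · simp only [eval_add, eval_mul, eval_C, eval_X]
    rw [mul_eq_zero, eval_calP_odd]
    right
    linear_combination (calP (2 * l + 1)).eval (-(Complex.I / 2)) * Complex.I_mul_I

theorem eq_mul_divByMonic_of_dvd {P : ℂ[X]} (h : X ^ 2 + C (1 / 4) ∣ P) :
    P = C (-(1 / 2)) * (C (1 / 4) + X ^ 2) * ((C (-2) * P) /ₘ (X ^ 2 + C (1 / 4))) := by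
  have h1 := modByMonic_add_div (C (-2) * P) (X ^ 2 + C (1 / 4))
  rw [(modByMonic_eq_zero_iff_dvd monic_X_sq_add_C).mpr (h.mul_left _), zero_add] at h1
  rw [mul_assoc, add_comm (C (1 / 4)), h1, ← mul_assoc, ← C_mul]
  norm_num

theorem PPlus_eq_mul_RPlus (l : ℕ) :
    PPlus l = C (-(1 / 2)) * (C (1 / 4) + X ^ 2) * RPlus l :=
  eq_mul_divByMonic_of_dvd (X_sq_add_C_dvd_PPlus l)

theorem PMinus_eq_mul_RMinus (l : ℕ) :
    PMinus l = C (-(1 / 2)) * (C (1 / 4) + X ^ 2) * RMinus l :=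
  eq_mul_divByMonic_of_dvd (X_sq_add_C_dvd_PMinus l)

theorem degree_calP (m : ℕ) : (calP m).degree = m := by
  have hs : ((√((2 * m)! : ℝ) : ℝ) : ℂ) ≠ 0 := by
    have : (0 : ℝ) < √((2 * m)! : ℝ) := Real.sqrt_pos.mpr (by positivity)
    exact_mod_cast this.ne'
  have hdeg (k : ℕ) : (C ((calPCoeff m k : ℝ) : ℂ) * risingPoly k).degree = k := by
    rw [degree_C_mul (by exact_mod_cast calPCoeff_ne_zero m k), degree_risingPoly]
  rw [calP_eq, degree_C_mul hs, Finset.sum_range_succ, degree_add_eq_right_of_degree_lt, hdeg]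
  rw [hdeg]
  refine (degree_sum_le _ _).trans_lt ?_
  refine (Finset.sup_lt_iff (WithBot.bot_lt_coe m)).mpr fun k hk => ?_
  rw [hdeg]
  exact WithBot.coe_lt_coe.mpr (Finset.mem_range.mp hk)

theorem two_rpow_neg_ne_zero : (((2 : ℝ) ^ (-(3 / 4) : ℝ) : ℝ) : ℂ) ≠ 0 := by
  have : (0 : ℝ) < (2 : ℝ) ^ (-(3 / 4) : ℝ) := by positivity
  exact_mod_cast this.ne'

/-- The index is shifted because `P^±_0 = 0`; from `ℓ = 1` on, the corrections have too low a degree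
to affect the leading term of `𝒫`. -/
theorem degree_PPlus (l : ℕ) : (PPlus (l + 1)).degree = (2 * (l + 1) : ℕ) := by
  rw [PPlus_eq, degree_C_mul two_rpow_neg_ne_zero, degree_sub_eq_left_of_degree_lt, degree_calP]
  rw [degree_calP]
  refine degree_C_le.trans_lt ?_
  exact_mod_cast (by lia : 0 < 2 * (l + 1))

theorem degree_PMinus (l : ℕ) : (PMinus (l + 1)).degree = (2 * (l + 1) + 1 : ℕ) := by
  rw [PMinus_eq, degree_C_mul two_rpow_neg_ne_zero, degree_add_eq_left_of_degree_lt, degree_calP]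
  rw [degree_calP]
  refine (degree_C_mul_X_le _).trans_lt ?_
  exact_mod_cast (by lia : 1 < 2 * (l + 1) + 1)

theorem degree_divByMonic_X_sq_add_C {P : ℂ[X]} {n : ℕ} (h : P.degree = ((n + 2 : ℕ) : WithBot ℕ)) :
    ((C (-2) * P) /ₘ (X ^ 2 + C (1 / 4))).degree = n := by
  have hP : (C (-2) * P).degree = ((n + 2 : ℕ) : WithBot ℕ) := by
    rw [degree_C_mul (by norm_num), h]
  have hn := natDegree_divByMonic (C (-2) * P) monic_X_sq_add_C
  rw [natDegree_X_pow_add_C, natDegree_eq_of_degree_eq_some hP, Nat.add_sub_cancel] at hn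
  have h0 : (C (-2) * P) /ₘ (X ^ 2 + C (1 / 4)) ≠ 0 := by
    rw [Ne, divByMonic_eq_zero_iff monic_X_sq_add_C, not_lt, hP, degree_X_pow_add_C two_pos]
    exact_mod_cast (by lia : 2 ≤ n + 2)
  rw [degree_eq_natDegree h0, hn]

theorem degree_RPlus (l : ℕ) : (RPlus (l + 1)).degree = (2 * l : ℕ) :=
  degree_divByMonic_X_sq_add_C (degree_PPlus l)

theorem degree_RMinus (l : ℕ) : (RMinus (l + 1)).degree = (2 * l + 1 : ℕ) :=
  degree_divByMonic_X_sq_add_C (degree_PMinus l)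

/-- The sequence `R⁺_1, R⁻_1, R⁺_2, R⁻_2, …`, whose `i`-th term has degree `i`. -/
def RSequence : Polynomial.Sequence ℂ where
  elems' i := if Even i then RPlus (i / 2 + 1) else RMinus (i / 2 + 1)
  degree_eq' i := by
    split_ifs with h
    · rw [degree_RPlus, Nat.two_mul_div_two_of_even h]
    · rw [degree_RMinus, Nat.two_mul_div_two_add_one_of_odd (Nat.not_even_iff_odd.mp h)]

theorem span_RPlus_union_RMinus :
    Submodule.span ℂ (Set.range RPlus ∪ Set.range RMinus) = ⊤ := by
  rw [eq_top_iff, ← RSequence.span fun i => by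
    rw [isUnit_iff_ne_zero, leadingCoeff_ne_zero]; exact RSequence.ne_zero i]
  refine Submodule.span_mono ?_
  rintro _ ⟨i, rfl⟩
  change (if Even i then RPlus (i / 2 + 1) else RMinus (i / 2 + 1)) ∈ _
  split_ifs
  · exact Or.inl ⟨_, rfl⟩
  · exact Or.inr ⟨_, rfl⟩

/-! ### Evaluation, division and the spectrum in `H_{≤1}`. -/

namespace HadamardRing

theorem toFun_injective : Function.Injective toFun := fun _ _ h => Subtype.ext h

theorem differentiable_toFun (f : HadamardRing) : Differentiable ℂ f.toFun := f.2.1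

theorem toFun_add (f g : HadamardRing) (z : ℂ) : (f + g).toFun z = f.toFun z + g.toFun z := rfl

theorem toFun_sub (f g : HadamardRing) (z : ℂ) : (f - g).toFun z = f.toFun z - g.toFun z := rfl

theorem toFun_mul (f g : HadamardRing) (z : ℂ) : (f * g).toFun z = f.toFun z * g.toFun z := rfl

theorem toFun_smul (c : ℂ) (f : HadamardRing) (z : ℂ) : (c • f).toFun z = c * f.toFun z := rfl

theorem toFun_coord (z : ℂ) : coord.toFun z = z := rfl

theorem toFun_one (z : ℂ) : (1 : HadamardRing).toFun z = 1 := rfl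

/-- Evaluation at a point, as an algebra homomorphism. -/
def evalHom (a : ℂ) : HadamardRing →ₐ[ℂ] ℂ where
  toFun f := f.toFun a
  map_one' := rfl
  map_mul' _ _ := rfl
  map_zero' := rfl
  map_add' _ _ := rfl
  commutes' _ := rfl

theorem toFun_aeval_coord (p : ℂ[X]) (z : ℂ) : (aeval coord p).toFun z = p.eval z := by
  change evalHom z (aeval coord p) = _
  rw [← aeval_algHom_apply]
  rfl

theorem norm_toFun_le (ε : Set.Ioi (0 : ℝ)) (f : HadamardRing) (z : ℂ) :
    ‖f.toFun z‖ ≤ growthSeminorm ε f * Real.exp (‖z‖ ^ (1 + (ε : ℝ))) := by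
  have h : ‖f.toFun z‖ * Real.exp (-‖z‖ ^ (1 + (ε : ℝ))) ≤ growthSeminorm ε f :=
    le_ciSup (f.bddAbove_weight ε) z
  rwa [Real.exp_neg, ← div_eq_mul_inv, div_le_iff₀ (Real.exp_pos _)] at h

theorem growthSeminorm_le {ε : Set.Ioi (0 : ℝ)} {f : HadamardRing} {A : ℝ}
    (h : ∀ z, ‖f.toFun z‖ ≤ A * Real.exp (‖z‖ ^ (1 + (ε : ℝ)))) : growthSeminorm ε f ≤ A := by
  rw [growthSeminorm_apply]
  refine ciSup_le fun z => ?_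
  rw [Real.exp_neg, ← div_eq_mul_inv, div_le_iff₀ (Real.exp_pos _)]
  exact h z

/-- Evaluation at a point, as a continuous linear form. -/
def evalCLM (a : ℂ) : HadamardRing →L[ℂ] ℂ where
  toLinearMap := (evalHom a).toLinearMap
  cont := by
    refine WithSeminorms.continuous_normedSpace_rng ℂ withSeminorms _
      ⟨{⟨1, Set.mem_Ioi.mpr one_pos⟩}, ⟨Real.exp (‖a‖ ^ (1 + 1 : ℝ)), (Real.exp_pos _).le⟩, fun f => ?_⟩
    rw [Finset.sup_singleton]
    change ‖f.toFun a‖ ≤ Real.exp (‖a‖ ^ (1 + 1 : ℝ)) * growthSeminorm ⟨1, Set.mem_Ioi.mpr one_pos⟩ f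
    rw [mul_comm]
    exact norm_toFun_le ⟨1, Set.mem_Ioi.mpr one_pos⟩ f a

theorem evalCLM_apply (a : ℂ) (f : HadamardRing) : evalCLM a f = f.toFun a := rfl

theorem sub_mul_left_cancel {a : ℂ} {f g : HadamardRing}
    (h : ∀ z, (z - a) * f.toFun z = (z - a) * g.toFun z) : f = g := by
  refine toFun_injective (Continuous.ext_on (dense_compl_singleton a)
    f.differentiable_toFun.continuous g.differentiable_toFun.continuous fun z hz => ?_)
  exact mul_left_cancel₀ (sub_ne_zero.mpr hz) (h z)

/-- Outside the unit disc around `a`, dividing by `z - a` does not increase the norm; inside, the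
maximum principle reduces to the bounding circle. No loss in `ε` occurs, which gives the continuity
of division. -/
theorem norm_dslope_le (a : ℂ) (ε : Set.Ioi (0 : ℝ)) (f : HadamardRing) (z : ℂ) :
    ‖dslope f.toFun a z‖ ≤ (1 + 2 * Real.exp ((‖a‖ + 1) ^ (1 + (ε : ℝ)))) * growthSeminorm ε f *
      Real.exp (‖z‖ ^ (1 + (ε : ℝ))) := by
  set p := growthSeminorm ε f
  set M := Real.exp ((‖a‖ + 1) ^ (1 + (ε : ℝ))) with hM
  have hp : 0 ≤ p := apply_nonneg _ _
  have hM1 : 1 ≤ M := Real.one_le_exp (by positivity)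
  have hε : 0 < (ε : ℝ) := ε.2
  have hnear (w : ℂ) (hw : ‖w - a‖ ≤ 1) : ‖f.toFun w‖ ≤ p * M := by
    refine (norm_toFun_le ε f w).trans ?_
    gcongr
    rw [hM]
    gcongr
    calc ‖w‖ = ‖a + (w - a)‖ := by ring_nf
      _ ≤ ‖a‖ + ‖w - a‖ := norm_add_le _ _
      _ ≤ ‖a‖ + 1 := by gcongr
  have ha := hnear a (by simp)
  have hfar (w : ℂ) (hw : 1 ≤ ‖w - a‖) : ‖dslope f.toFun a w‖ ≤ ‖f.toFun w‖ + ‖f.toFun a‖ := by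
    have h0 : w ≠ a := by rintro rfl; simp at hw; linarith
    rw [dslope_of_ne _ h0, slope_def_field, norm_div]
    exact (div_le_self (norm_nonneg _) hw).trans (norm_sub_le _ _)
  have hz1 : 1 ≤ Real.exp (‖z‖ ^ (1 + (ε : ℝ))) := Real.one_le_exp (by positivity)
  rcases le_total 1 ‖z - a‖ with h | h
  · refine (hfar z h).trans ((add_le_add (norm_toFun_le ε f z) ha).trans ?_)
    change p * Real.exp (‖z‖ ^ (1 + (ε : ℝ))) + p * M ≤ _
    have : p * M ≤ p * M * Real.exp (‖z‖ ^ (1 + (ε : ℝ))) :=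
      le_mul_of_one_le_right (by positivity) hz1
    have h3 : 0 ≤ p * M * Real.exp (‖z‖ ^ (1 + (ε : ℝ))) := by positivity
    linarith
  · have hdiff : Differentiable ℂ (dslope f.toFun a) := by
      rw [← differentiableOn_univ, Complex.differentiableOn_dslope univ_mem]
      exact f.differentiable_toFun.differentiableOn
    have hmax : ‖dslope f.toFun a z‖ ≤ p * M + p * M := by
      refine Complex.norm_le_of_forall_mem_frontier_norm_le (Metric.isBounded_ball (x := a) (r := 1))
        hdiff.diffContOnCl (fun w hw => ?_) ?_
      · rw [frontier_ball _ one_ne_zero, mem_sphere_iff_norm] at hw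
        exact (hfar w hw.ge).trans (add_le_add (hnear w hw.le) ha)
      · rw [closure_ball _ one_ne_zero, mem_closedBall_iff_norm]
        exact h
    refine hmax.trans ((?_ : _ ≤ (1 + 2 * M) * p).trans (le_mul_of_one_le_right (by positivity) hz1))
    linarith

/-- The difference quotient `f ↦ (f - f(a)) / (s - a)`. -/
def divDiff (a : ℂ) (f : HadamardRing) : HadamardRing :=
  ⟨dslope f.toFun a, by
    rw [← differentiableOn_univ, Complex.differentiableOn_dslope univ_mem]
    exact f.differentiable_toFun.differentiableOn,
    fun ε hε => ⟨_, norm_dslope_le a ⟨ε, hε⟩ f⟩⟩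

theorem sub_mul_toFun_divDiff (a : ℂ) (f : HadamardRing) (z : ℂ) :
    (z - a) * (divDiff a f).toFun z = f.toFun z - f.toFun a :=
  sub_smul_dslope f.toFun a z

/-- The difference quotient, as a linear map. -/
def divDiffLM (a : ℂ) : HadamardRing →ₗ[ℂ] HadamardRing where
  toFun := divDiff a
  map_add' f g := sub_mul_left_cancel (a := a) fun z => by
    rw [toFun_add, mul_add]
    simp only [sub_mul_toFun_divDiff, toFun_add]
    ring
  map_smul' c f := sub_mul_left_cancel (a := a) fun z => by
    rw [RingHom.id_apply, toFun_smul, mul_left_comm]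
    simp only [sub_mul_toFun_divDiff, toFun_smul]
    ring

/-- The difference quotient, as a continuous operator. -/
def divDiffCLM (a : ℂ) : HadamardRing →L[ℂ] HadamardRing where
  toLinearMap := divDiffLM a
  cont := by
    refine WithSeminorms.continuous_of_isBounded withSeminorms withSeminorms
      (divDiffLM a) fun ε => ⟨{ε},
        ⟨1 + 2 * Real.exp ((‖a‖ + 1) ^ (1 + (ε : ℝ))), by positivity⟩, fun f => ?_⟩
    rw [Finset.sup_singleton]
    change growthSeminorm ε (divDiff a f)
      ≤ (1 + 2 * Real.exp ((‖a‖ + 1) ^ (1 + (ε : ℝ)))) * growthSeminorm ε f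
    exact growthSeminorm_le (norm_dslope_le a ε f)

/-- The polynomial multiples of `Z`. -/
def polyMul (Z : HadamardRing) : ℂ[X] →ₗ[ℂ] HadamardRing :=
  LinearMap.mulRight ℂ Z ∘ₗ (aeval coord).toLinearMap

theorem toFun_polyMul (Z : HadamardRing) (p : ℂ[X]) (z : ℂ) :
    (polyMul Z p).toFun z = p.eval z * Z.toFun z := by
  change (aeval coord p * Z).toFun z = _
  rw [toFun_mul, toFun_aeval_coord]

/-- The closure of the space of polynomial multiples of `Z`. -/
def closedPolySpan (Z : HadamardRing) : Submodule ℂ HadamardRing :=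
  (LinearMap.range (polyMul Z)).topologicalClosure

theorem mapsTo_closedPolySpan {Z : HadamardRing} (T : HadamardRing →L[ℂ] HadamardRing)
    (h : ∀ p, ∃ q, T (polyMul Z p) = polyMul Z q) :
    ∀ f ∈ closedPolySpan Z, T f ∈ closedPolySpan Z := by
  have h1 : Set.MapsTo T (LinearMap.range (polyMul Z)) (LinearMap.range (polyMul Z)) := by
    rintro _ ⟨p, rfl⟩
    obtain ⟨q, hq⟩ := h p
    exact ⟨q, hq.symm⟩
  exact h1.closure T.continuous

theorem mulS_mem_closedPolySpan (Z : HadamardRing) :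
    ∀ f ∈ closedPolySpan Z, mulS f ∈ closedPolySpan Z := by
  refine mapsTo_closedPolySpan mulS fun p => ⟨X * p, toFun_injective (funext fun z => ?_)⟩
  change (coord * polyMul Z p).toFun z = _
  rw [toFun_mul, toFun_polyMul, toFun_polyMul, toFun_coord, eval_mul, eval_X]
  ring

theorem self_mem_closedPolySpan (Z : HadamardRing) : Z ∈ closedPolySpan Z := by
  refine Submodule.le_topologicalClosure _ ⟨1, toFun_injective (funext fun z => ?_)⟩
  rw [toFun_polyMul, eval_one, one_mul]

theorem toFun_eq_zero_of_mem_closedPolySpan {Z : HadamardRing} {a : ℂ} (ha : Z.toFun a = 0)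
    {f : HadamardRing} (hf : f ∈ closedPolySpan Z) : f.toFun a = 0 := by
  have h1 : Set.MapsTo (evalCLM a) (LinearMap.range (polyMul Z)) {0} := by
    rintro _ ⟨p, rfl⟩
    simp [evalCLM_apply, toFun_polyMul, ha]
  have := h1.closure (evalCLM a).continuous hf
  simpa [evalCLM_apply] using this

/-- The operator `f ↦ (f - (f(a) / Z(a)) Z) / (s - a)`. -/
def resolventLift (Z : HadamardRing) (a : ℂ) : HadamardRing →L[ℂ] HadamardRing :=
  divDiffCLM a ∘L (ContinuousLinearMap.id ℂ HadamardRing -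
    ContinuousLinearMap.smulRight (evalCLM a) ((Z.toFun a)⁻¹ • Z))

theorem sub_mul_toFun_resolventLift {Z : HadamardRing} {a : ℂ} (ha : Z.toFun a ≠ 0)
    (f : HadamardRing) (z : ℂ) : (z - a) * (resolventLift Z a f).toFun z =
      f.toFun z - f.toFun a / Z.toFun a * Z.toFun z := by
  have : resolventLift Z a f = divDiff a (f - f.toFun a • (Z.toFun a)⁻¹ • Z) := rfl
  rw [this, sub_mul_toFun_divDiff]
  simp only [toFun_sub, toFun_smul]
  field_simp
  ring

/-- By continuity it suffices to treat `pZ`, which is sent to `((p - p(a))/(s - a)) Z`, again a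
polynomial multiple of `Z`. -/
theorem resolventLift_mem_closedPolySpan {Z : HadamardRing} {a : ℂ} (ha : Z.toFun a ≠ 0) :
    ∀ f ∈ closedPolySpan Z, resolventLift Z a f ∈ closedPolySpan Z := by
  refine mapsTo_closedPolySpan _ fun p => ⟨p /ₘ (X - C a), sub_mul_left_cancel (a := a) fun z => ?_⟩
  rw [sub_mul_toFun_resolventLift ha]
  simp only [toFun_polyMul]
  have h := congrArg (eval z) (modByMonic_add_div p (X - C a))
  rw [modByMonic_X_sub_C_eq_C_eval] at h
  simp only [eval_add, eval_mul, eval_sub, eval_C, eval_X] at h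
  rw [mul_div_assoc, div_self ha]
  linear_combination (-Z.toFun z) * h

theorem algebraMap_sub_quotientMulS_mk (V : Submodule ℂ HadamardRing) (hV : ∀ f ∈ V, mulS f ∈ V)
    (a : ℂ) (f : HadamardRing) :
    (algebraMap ℂ ((HadamardRing ⧸ V) →L[ℂ] (HadamardRing ⧸ V)) a - quotientMulS V hV)
      (Submodule.Quotient.mk f) = Submodule.Quotient.mk (a • f - coord * f) := rfl

/-- The spectrum of multiplication by `s` on the quotient of `H_{≤1}` by the closure of the
polynomial multiples of `Z` is the zero set of `Z`. -/
theorem spectrum_quotientMulS (Z : HadamardRing)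
    (hV : ∀ f ∈ closedPolySpan Z, mulS f ∈ closedPolySpan Z) :
    spectrum ℂ (quotientMulS (closedPolySpan Z) hV) = {a | Z.toFun a = 0} := by
  ext a
  rw [spectrum.mem_iff, Set.mem_ofPred_eq]
  refine ⟨fun h => ?_, fun ha hu => ?_⟩
  · by_contra ha
    refine h ?_
    -- The sign appears because the spectrum is defined by `a - s`, whereas the lift divides by `s -
    -- a`.
    let B : (HadamardRing ⧸ closedPolySpan Z) →L[ℂ] (HadamardRing ⧸ closedPolySpan Z) :=
      (closedPolySpan Z).liftQL ((closedPolySpan Z).mkQL ∘L (-resolventLift Z a)) fun f hf => by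
        simpa using resolventLift_mem_closedPolySpan ha f hf
    have hB (f : HadamardRing) :
        B (Submodule.Quotient.mk f) = Submodule.Quotient.mk (-resolventLift Z a f) := rfl
    have hneg (f : HadamardRing) (z : ℂ) : (-f).toFun z = -f.toFun z := rfl
    refine ⟨⟨_, B, ?_, ?_⟩, rfl⟩
    · ext x
      obtain ⟨f, rfl⟩ := Submodule.Quotient.mk_surjective _ x
      rw [mul_apply_eq_comp, hB, algebraMap_sub_quotientMulS_mk,
        one_apply_eq_self, Submodule.Quotient.eq]
      -- On this side the inverse is exact only up to a multiple of `Z`, which is zero in the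
      -- quotient.
      have : a • -resolventLift Z a f - coord * -resolventLift Z a f - f
          = (-(f.toFun a / Z.toFun a)) • Z := by
        refine toFun_injective (funext fun z => ?_)
        have := sub_mul_toFun_resolventLift ha f z
        simp only [toFun_sub, toFun_smul, toFun_mul, toFun_coord, hneg]
        linear_combination this
      rw [this]
      exact Submodule.smul_mem _ _ (self_mem_closedPolySpan Z)
    · ext x
      obtain ⟨f, rfl⟩ := Submodule.Quotient.mk_surjective _ x
      rw [mul_apply_eq_comp, algebraMap_sub_quotientMulS_mk, hB,
        one_apply_eq_self]
      congr 1
      -- On this side equality already holds in `H_{≤1}`: `(a - s) f` vanishes at `a`, so the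
      -- correction by `Z` is zero.
      refine sub_mul_left_cancel (a := a) fun z => ?_
      have := sub_mul_toFun_resolventLift ha (a • f - coord * f) z
      simp only [toFun_sub, toFun_smul, toFun_mul, toFun_coord, hneg] at this ⊢
      rw [mul_neg, this]
      ring
  -- Surjectivity would give `f` with `(a - s) f - 1` in the closed span; but its value at `a` is
  -- `-1`, and the closed span vanishes there.
  · obtain ⟨x, hx⟩ : ∃ x, (algebraMap ℂ _ a - quotientMulS (closedPolySpan Z) hV) x
        = Submodule.Quotient.mk (1 : HadamardRing) := by
      obtain ⟨u, hu⟩ := hu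
      refine ⟨(u⁻¹).val (Submodule.Quotient.mk 1), ?_⟩
      rw [← hu, ← mul_apply_eq_comp, Units.mul_inv, one_apply_eq_self]
    obtain ⟨f, rfl⟩ := Submodule.Quotient.mk_surjective _ x
    rw [algebraMap_sub_quotientMulS_mk, Submodule.Quotient.eq] at hx
    have := toFun_eq_zero_of_mem_closedPolySpan ha hx
    simp [toFun_sub, toFun_smul, toFun_mul, toFun_coord, toFun_one] at this

end HadamardRing

/-! ### The map `E` on Schwartz functions: decay, Poisson summation, Mellin transform. -/

/-- The sum `∑_{n ≥ 1} f(nu)`. -/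
def dilateSum (f : ℝ → ℂ) (u : ℝ) : ℂ := ∑' n : ℕ, f (((n : ℝ) + 1) * u)

theorem norm_le_inv_pow_of_schwartz (F : 𝓢(ℝ, ℂ)) (N : ℕ) :
    ∃ C : ℝ, 0 < C ∧ ∀ x : ℝ, x ≠ 0 → ‖F x‖ ≤ C * (|x| ^ N)⁻¹ := by
  obtain ⟨C, hC, h⟩ := F.decay N 0
  refine ⟨C, hC, fun x hx => ?_⟩
  have := h x
  rw [norm_iteratedFDeriv_zero, Real.norm_eq_abs] at this
  have hx : 0 < |x| ^ N := by positivity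
  rwa [← div_eq_mul_inv, le_div_iff₀ hx, mul_comm]

theorem summable_inv_nat_add_one_pow {N : ℕ} (hN : 2 ≤ N) :
    Summable fun n : ℕ => (((n : ℝ) + 1) ^ N)⁻¹ := by
  have := (summable_nat_add_iff 1).mpr (Real.summable_nat_pow_inv.mpr (by lia : 1 < N))
  simpa using this

theorem norm_dilate_le {F : ℝ → ℂ} {C : ℝ} {N : ℕ}
    (h : ∀ x : ℝ, x ≠ 0 → ‖F x‖ ≤ C * (|x| ^ N)⁻¹) (n : ℕ) {u : ℝ} (hu : 0 < u) :
    ‖F (((n : ℝ) + 1) * u)‖ ≤ C * (u ^ N)⁻¹ * (((n : ℝ) + 1) ^ N)⁻¹ := by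
  refine (h _ (by positivity)).trans (le_of_eq ?_)
  rw [abs_of_pos (by positivity), mul_pow, mul_inv]
  ring

theorem summable_dilate (F : 𝓢(ℝ, ℂ)) {u : ℝ} (hu : 0 < u) :
    Summable fun n : ℕ => F (((n : ℝ) + 1) * u) := by
  obtain ⟨C, -, h⟩ := norm_le_inv_pow_of_schwartz F 2
  exact Summable.of_norm_bounded ((summable_inv_nat_add_one_pow le_rfl).mul_left _)
    fun n => norm_dilate_le h n hu

theorem norm_dilateSum_le_inv_pow (F : 𝓢(ℝ, ℂ)) {N : ℕ} (hN : 2 ≤ N) :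
    ∃ C : ℝ, ∀ u : ℝ, 0 < u → ‖dilateSum F u‖ ≤ C * (u ^ N)⁻¹ := by
  obtain ⟨C, -, h⟩ := norm_le_inv_pow_of_schwartz F N
  refine ⟨C * ∑' n : ℕ, (((n : ℝ) + 1) ^ N)⁻¹, fun u hu => ?_⟩
  have := tsum_of_norm_bounded (((summable_inv_nat_add_one_pow hN).mul_left
    (C * (u ^ N)⁻¹)).hasSum) (fun n => norm_dilate_le h n hu)
  rw [tsum_mul_left] at this
  exact this.trans (le_of_eq (by ring))

theorem continuousOn_dilateSum (F : 𝓢(ℝ, ℂ)) : ContinuousOn (dilateSum F) (Set.Ioi 0) := by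
  obtain ⟨C, hC, h⟩ := norm_le_inv_pow_of_schwartz F 2
  intro u hu
  have hu : 0 < u := hu
  have h1 : ContinuousOn (dilateSum F) (Set.Ioi (u / 2)) := by
    refine continuousOn_tsum (u := fun n : ℕ => C * ((u / 2) ^ 2)⁻¹ * (((n : ℝ) + 1) ^ 2)⁻¹)
      (fun n => (F.continuous.comp (by fun_prop)).continuousOn)
      ((summable_inv_nat_add_one_pow le_rfl).mul_left _) fun n v hv => ?_
    have hv : u / 2 < v := hv
    refine (norm_dilate_le h n (by linarith)).trans ?_
    gcongr
  exact (h1.continuousAt (Ioi_mem_nhds (by linarith))).continuousWithinAt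

theorem fourier_comp_mul_left (f : ℝ → ℂ) {u : ℝ} (hu : 0 < u) (y : ℝ) :
    𝓕 (fun x => f (u * x)) y = (u : ℂ)⁻¹ * 𝓕 f (y / u) := by
  rw [Real.fourier_real_eq_integral_exp_smul, Real.fourier_real_eq_integral_exp_smul]
  have := Measure.integral_comp_mul_left
    (fun v : ℝ => Complex.exp (↑(-2 * Real.pi * v * (y / u)) * Complex.I) • f v) u
  rw [abs_of_pos (inv_pos.mpr hu)] at this
  simp only [smul_eq_mul] at this ⊢
  rw [← Complex.ofReal_inv, ← Complex.real_smul, ← this]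
  congr 1
  ext x
  congr 4
  field_simp

/-- Poisson summation for `x ↦ F(ux)`; evenness and `F(0) = 0` fold the sum over `ℤ` into twice the
sum over `n ≥ 1`. -/
theorem two_mul_dilateSum (F : 𝓢(ℝ, ℂ)) (heven : ∀ x, F (-x) = F x) (h0 : F 0 = 0) {u : ℝ}
    (hu : 0 < u) : 2 * dilateSum F u = (u : ℂ)⁻¹ * ∑' n : ℤ, 𝓕 F ((n : ℝ) / u) := by
  let G : 𝓢(ℝ, ℂ) := SchwartzMap.compCLMOfContinuousLinearEquiv ℂ
    (ContinuousLinearEquiv.unitsEquivAut ℝ (Units.mk0 u hu.ne')) F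
  have hG (x : ℝ) : G x = F (u * x) := by
    change F (x * u) = _
    rw [mul_comm]
  have hP := SchwartzMap.tsum_eq_tsum_fourier G 0
  have hfun : (G : ℝ → ℂ) = fun x => F (u * x) := funext hG
  have hF (n : ℤ) : 𝓕 G (n : ℝ) = (u : ℂ)⁻¹ * 𝓕 F ((n : ℝ) / u) := by
    rw [SchwartzMap.fourier_coe, SchwartzMap.fourier_coe, hfun, fourier_comp_mul_left _ hu]
  simp only [zero_add, hF, hG] at hP
  have hsum : Summable fun n : ℤ => F (u * n) := by
    have hs : Summable fun n : ℕ => F (u * ((n : ℕ) : ℤ)) := by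
      rw [← summable_nat_add_iff 1]
      refine (summable_dilate F hu).congr fun n => ?_
      push_cast
      rw [mul_comm]
    refine Summable.of_nat_of_neg hs (hs.congr fun n => ?_)
    push_cast
    rw [mul_neg, heven]
  rw [tsum_int_eq_zero_add_two_mul_tsum_pnat (fun n => by push_cast; rw [mul_neg, heven]) hsum] at hP
  rw [← tsum_mul_left, dilateSum]
  simp only [Int.cast_zero, mul_zero, h0, zero_add] at hP
  rw [tsum_pnat_eq_tsum_succ (f := fun n : ℕ => F (u * ((n : ℤ) : ℝ)))] at hP
  simpa [mul_comm] using hP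

/-- On the Fourier side the zero frequency is `∫F = 0`, and the others are `O((u/|n|)^N)`. One power
of `u` is lost to the factor `u⁻¹` in Poisson's formula. -/
theorem norm_dilateSum_le_pow (F : 𝓢(ℝ, ℂ)) (heven : ∀ x, F (-x) = F x) (h0 : F 0 = 0)
    (hint : ∫ x, F x = 0) {N : ℕ} (hN : 2 ≤ N) :
    ∃ C : ℝ, ∀ u : ℝ, 0 < u → ‖dilateSum F u‖ ≤ C * u ^ (N - 1) := by
  obtain ⟨C, hC, h⟩ := norm_le_inv_pow_of_schwartz (𝓕 F) N
  have hF0 : 𝓕 F 0 = 0 := by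
    rw [SchwartzMap.fourier_coe, Real.fourier_real_eq_integral_exp_smul]
    simpa using hint
  -- The term `n = 0` is `0⁻¹ = 0`, which agrees with the vanishing zero frequency in `hb`.
  have hs : Summable fun n : ℤ => (|(n : ℝ)| ^ N)⁻¹ := by
    have := Real.summable_abs_int_rpow (b := N) (by exact_mod_cast hN)
    refine this.congr fun n => ?_
    rw [Real.rpow_neg (abs_nonneg _), Real.rpow_natCast]
  refine ⟨C * (∑' n : ℤ, (|(n : ℝ)| ^ N)⁻¹) / 2, fun u hu => ?_⟩
  have hb (n : ℤ) : ‖𝓕 F ((n : ℝ) / u)‖ ≤ C * u ^ N * (|(n : ℝ)| ^ N)⁻¹ := by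
    rcases eq_or_ne n 0 with rfl | hn
    · rw [Int.cast_zero, zero_div, hF0, norm_zero]
      positivity
    · refine (h _ (div_ne_zero (by exact_mod_cast hn) hu.ne')).trans (le_of_eq ?_)
      rw [abs_div, abs_of_pos hu, div_pow, inv_div]
      ring
  have h1 := tsum_of_norm_bounded ((hs.mul_left (C * u ^ N)).hasSum) hb
  have h2 := congrArg norm (two_mul_dilateSum F heven h0 hu)
  rw [norm_mul, norm_mul, norm_inv, Complex.norm_real, Real.norm_of_nonneg hu.le,
    Complex.norm_ofNat] at h2
  rw [tsum_mul_left] at h1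
  have h3 : u⁻¹ * u ^ N = u ^ (N - 1) := by
    obtain ⟨M, rfl⟩ : ∃ M, N = M + 1 := ⟨N - 1, by lia⟩
    rw [pow_succ, Nat.add_sub_cancel]
    field_simp
  have h4 : u⁻¹ * ‖∑' n : ℤ, 𝓕 F ((n : ℝ) / u)‖
      ≤ u⁻¹ * (C * u ^ N * ∑' n : ℤ, (|(n : ℝ)| ^ N)⁻¹) := by gcongr
  rw [← h3]
  linarith

/-- `E(f)` for complex-valued functions. -/
def mapEC (f : ℝ → ℂ) (u : ℝ) : ℂ := (√u : ℂ) * dilateSum f u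

theorem ofReal_mapE (f : ℝ → ℝ) (u : ℝ) : (mapE f u : ℂ) = mapEC (fun x => (f x : ℂ)) u := by
  rw [mapE, mapEC, dilateSum]
  push_cast
  rfl

theorem locallyIntegrableOn_mapEC (F : 𝓢(ℝ, ℂ)) : LocallyIntegrableOn (mapEC F) (Set.Ioi 0) := by
  refine ContinuousOn.locallyIntegrableOn ?_ measurableSet_Ioi
  exact ContinuousOn.mul (by fun_prop) (continuousOn_dilateSum F)

theorem norm_mapEC (f : ℝ → ℂ) (u : ℝ) : ‖mapEC f u‖ = √u * ‖dilateSum f u‖ := by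
  rw [mapEC, norm_mul, Complex.norm_real, Real.norm_of_nonneg (Real.sqrt_nonneg u)]

theorem mapEC_isBigO_atTop (F : 𝓢(ℝ, ℂ)) {N : ℕ} (hN : 2 ≤ N) :
    mapEC F =O[atTop] fun u : ℝ => u ^ (-((N : ℝ) - 1 / 2)) := by
  obtain ⟨C, hC⟩ := norm_dilateSum_le_inv_pow F hN
  refine IsBigO.of_bound C ?_
  filter_upwards [eventually_gt_atTop 0] with u hu
  rw [norm_mapEC, Real.norm_of_nonneg (by positivity), Real.sqrt_eq_rpow, neg_sub,
    Real.rpow_sub hu, Real.rpow_natCast]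
  calc u ^ (1 / 2 : ℝ) * ‖dilateSum F u‖ ≤ u ^ (1 / 2 : ℝ) * (C * (u ^ N)⁻¹) := by
        gcongr; exact hC u hu
    _ = C * (u ^ (1 / 2 : ℝ) / u ^ N) := by ring

theorem mapEC_isBigO_zero (F : 𝓢(ℝ, ℂ)) (heven : ∀ x, F (-x) = F x) (h0 : F 0 = 0)
    (hint : ∫ x, F x = 0) {N : ℕ} (hN : 2 ≤ N) :
    mapEC F =O[𝓝[>] 0] fun u : ℝ => u ^ (-(-((N : ℝ) - 1 / 2))) := by
  obtain ⟨C, hC⟩ := norm_dilateSum_le_pow F heven h0 hint hN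
  refine IsBigO.of_bound C ?_
  filter_upwards [self_mem_nhdsWithin] with u hu
  have hu : 0 < u := hu
  have h1 : ((N - 1 : ℕ) : ℝ) = N - 1 := by
    rw [Nat.cast_sub (by lia), Nat.cast_one]
  rw [norm_mapEC, Real.norm_of_nonneg (by positivity), Real.sqrt_eq_rpow,
    show -(-((N : ℝ) - 1 / 2)) = 1 / 2 + ((N - 1 : ℕ) : ℝ) by rw [h1]; ring,
    Real.rpow_add hu, Real.rpow_natCast]
  calc u ^ (1 / 2 : ℝ) * ‖dilateSum F u‖ ≤ u ^ (1 / 2 : ℝ) * (C * u ^ (N - 1)) := by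
        gcongr; exact hC u hu
    _ = C * (u ^ (1 / 2 : ℝ) * u ^ (N - 1)) := by ring

theorem exists_two_le_abs_lt (σ : ℝ) : ∃ N : ℕ, 2 ≤ N ∧ |σ| < (N : ℝ) - 1 / 2 := by
  obtain ⟨N, hN⟩ := exists_nat_gt |σ|
  refine ⟨N + 2, by lia, ?_⟩
  push_cast
  linarith

/-- The bounds at `0` and `∞` with exponent `N` give convergence in `|Re s| < N - 1/2`, and `N` is
arbitrary. -/
theorem mellinConvergent_mapEC (F : 𝓢(ℝ, ℂ)) (heven : ∀ x, F (-x) = F x) (h0 : F 0 = 0)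
    (hint : ∫ x, F x = 0) (s : ℂ) : MellinConvergent (mapEC F) s := by
  obtain ⟨N, hN, hs⟩ := exists_two_le_abs_lt s.re
  exact mellinConvergent_of_isBigO_rpow (locallyIntegrableOn_mapEC F) (mapEC_isBigO_atTop F hN)
    (abs_lt.mp hs).2 (mapEC_isBigO_zero F heven h0 hint hN) (abs_lt.mp hs).1

theorem differentiable_mellin_mapEC (F : 𝓢(ℝ, ℂ)) (heven : ∀ x, F (-x) = F x) (h0 : F 0 = 0)
    (hint : ∫ x, F x = 0) : Differentiable ℂ (mellin (mapEC F)) := fun s => by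
  obtain ⟨N, hN, hs⟩ := exists_two_le_abs_lt s.re
  exact mellin_differentiableAt_of_isBigO_rpow (locallyIntegrableOn_mapEC F)
    (mapEC_isBigO_atTop F hN) (abs_lt.mp hs).2 (mapEC_isBigO_zero F heven h0 hint hN)
    (abs_lt.mp hs).1

/-- Dilation by `n + 1` scales the Mellin transform by `(n + 1)^(-w)`; `Re w > 1` makes the
integrals of norms summable, which permits termwise integration. -/
theorem mellin_dilateSum {f : ℝ → ℂ} {w : ℂ} (hf : MellinConvergent f w) (hw : 1 < w.re) :
    mellin (dilateSum f) w = riemannZeta w * mellin f w := by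
  have hpos (n : ℕ) : (0 : ℝ) < (n : ℝ) + 1 := by positivity
  have hint (n : ℕ) : IntegrableOn
      (fun t : ℝ => (t : ℂ) ^ (w - 1) * f (((n : ℝ) + 1) * t)) (Set.Ioi 0) :=
    (MellinConvergent.comp_mul_left (hpos n)).mpr hf
  have hnorm (n : ℕ) : ∫ t in Set.Ioi (0 : ℝ), ‖(t : ℂ) ^ (w - 1) * f (((n : ℝ) + 1) * t)‖
      = 1 / ((n : ℝ) + 1) ^ w.re * ∫ t in Set.Ioi (0 : ℝ), ‖(t : ℂ) ^ (w - 1) * f t‖ := by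
    have h1 := integral_comp_mul_left_Ioi (fun t : ℝ => ‖(t : ℂ) ^ (w - 1) * f t‖) 0 (hpos n)
    rw [mul_zero] at h1
    -- Rescale `t^(w-1)` so that the integrand depends on `(n + 1)t` alone and `h1` applies.
    have h2 : ∫ t in Set.Ioi (0 : ℝ), ‖(t : ℂ) ^ (w - 1) * f (((n : ℝ) + 1) * t)‖
        = ((n : ℝ) + 1) ^ (1 - w.re) * ∫ t in Set.Ioi (0 : ℝ),
          ‖((((n : ℝ) + 1) * t : ℝ) : ℂ) ^ (w - 1) * f (((n : ℝ) + 1) * t)‖ := by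
      rw [← integral_const_mul]
      refine setIntegral_congr_fun measurableSet_Ioi fun t ht => ?_
      have ht : 0 < t := ht
      simp only [norm_mul]
      rw [Complex.norm_cpow_eq_rpow_re_of_pos ht,
        Complex.norm_cpow_eq_rpow_re_of_pos (mul_pos (hpos n) ht),
        Real.mul_rpow (hpos n).le ht.le, Complex.sub_re, Complex.one_re, ← mul_assoc, ← mul_assoc,
        ← Real.rpow_add (hpos n)]
      simp
    rw [h2, h1, smul_eq_mul, ← mul_assoc, Real.rpow_sub (hpos n), Real.rpow_one]
    have := (hpos n).ne'
    field_simp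
  have hsum : Summable fun n : ℕ =>
      ∫ t in Set.Ioi (0 : ℝ), ‖(t : ℂ) ^ (w - 1) * f (((n : ℝ) + 1) * t)‖ := by
    simp only [hnorm]
    refine Summable.mul_right _ ?_
    have := (summable_nat_add_iff 1).mpr (Real.summable_one_div_nat_rpow.mpr hw)
    simpa using this
  have key := hasSum_integral_of_summable_integral_norm hint hsum
  have hterm (n : ℕ) : ∫ t in Set.Ioi (0 : ℝ), (t : ℂ) ^ (w - 1) * f (((n : ℝ) + 1) * t)
      = 1 / ((n : ℂ) + 1) ^ w * mellin f w := by
    have := mellin_comp_mul_left f w (hpos n)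
    rw [mellin] at this
    simp only [smul_eq_mul] at this
    rw [this, Complex.cpow_neg]
    push_cast
    rw [one_div]
  simp only [hterm] at key
  have hz := key.tsum_eq
  rw [tsum_mul_right, ← zeta_eq_tsum_one_div_nat_add_one_cpow hw] at hz
  rw [hz, mellin]
  refine setIntegral_congr_fun measurableSet_Ioi fun t _ => ?_
  simp only [dilateSum, smul_eq_mul, tsum_mul_left]

theorem mellin_mapEC {f : ℝ → ℂ} {w : ℂ} (hf : MellinConvergent f w) (hw : 1 < w.re) :
    mellin (mapEC f) (w - 1 / 2) = riemannZeta w * mellin f w := by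
  rw [← mellin_dilateSum hf hw]
  have h1 := mellin_cpow_smul (dilateSum f) (w - 1 / 2) (1 / 2)
  rw [sub_add_cancel] at h1
  rw [← h1]
  refine setIntegral_congr_fun measurableSet_Ioi fun t ht => ?_
  have ht : 0 ≤ t := le_of_lt ht
  simp only [smul_eq_mul, mapEC]
  rw [Real.sqrt_eq_rpow, Complex.ofReal_cpow ht]
  push_cast
  rfl

/-! ### Polynomials times the Gaussian: Schwartz property and Mellin transforms. -/

/-- The function `p(x) exp(-πx²)`. -/
def polyGauss (p : ℂ[X]) (x : ℝ) : ℂ := p.eval (x : ℂ) * Complex.exp (-Real.pi * (x : ℂ) ^ 2)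

theorem polyGauss_add (p q : ℂ[X]) : polyGauss (p + q) = fun x => polyGauss p x + polyGauss q x := by
  ext x
  rw [polyGauss, eval_add, add_mul]
  rfl

theorem polyGauss_C_mul (c : ℂ) (p : ℂ[X]) :
    polyGauss (C c * p) = fun x => c * polyGauss p x := by
  ext x
  rw [polyGauss, eval_mul, eval_C, mul_assoc]
  rfl

theorem hasDerivAt_polyGauss (p : ℂ[X]) (x : ℝ) :
    HasDerivAt (polyGauss p) (polyGauss (derivative p - C (2 * Real.pi : ℂ) * X * p) x) x := by
  have h1 : HasDerivAt (fun z : ℂ => p.eval z * Complex.exp (-Real.pi * z ^ 2))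
      ((derivative p).eval (x : ℂ) * Complex.exp (-Real.pi * (x : ℂ) ^ 2) +
        p.eval (x : ℂ) * (Complex.exp (-Real.pi * (x : ℂ) ^ 2) *
          (-Real.pi * (2 * (x : ℂ) ^ 1 * 1)))) (x : ℂ) :=
    (p.hasDerivAt _).mul ((((hasDerivAt_id (x : ℂ)).pow 2).const_mul _).cexp)
  refine (h1.comp_ofReal.congr_deriv ?_ : HasDerivAt (polyGauss p) _ x)
  simp only [polyGauss, eval_sub, eval_mul, eval_C, eval_X]
  ring

theorem contDiff_polyGauss (p : ℂ[X]) : ContDiff ℝ ⊤ (polyGauss p) := by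
  have h1 : ContDiff ℝ ⊤ fun x : ℝ => p.eval (x : ℂ) := by
    have : ContDiff ℂ ⊤ fun z : ℂ => p.eval z := by
      simpa [coe_aeval_eq_eval] using p.contDiff_aeval (𝕜 := ℂ) ⊤
    exact (this.restrict_scalars ℝ).comp Complex.ofRealCLM.contDiff
  refine h1.mul (ContDiff.cexp (contDiff_const.mul (ContDiff.pow ?_ 2)))
  exact Complex.ofRealCLM.contDiff

theorem exists_norm_eval_le_exp_abs (p : ℂ[X]) :
    ∃ C : ℝ, 0 ≤ C ∧ ∀ x : ℝ, ‖p.eval (x : ℂ)‖ ≤ C * Real.exp |x| := by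
  induction p using Polynomial.induction_on' with
  | add p q hp hq =>
    obtain ⟨A, hA, h1⟩ := hp
    obtain ⟨B, hB, h2⟩ := hq
    refine ⟨A + B, by positivity, fun x => ?_⟩
    rw [eval_add, add_mul]
    exact (norm_add_le _ _).trans (add_le_add (h1 x) (h2 x))
  | monomial n a =>
    refine ⟨‖a‖ * n !, by positivity, fun x => ?_⟩
    rw [eval_monomial, norm_mul, norm_pow, Complex.norm_real, Real.norm_eq_abs, mul_assoc]
    have := Real.pow_div_factorial_le_exp |x| (abs_nonneg x) n
    rw [div_le_iff₀ (by positivity), mul_comm] at this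
    gcongr

theorem exists_norm_polyGauss_le (p : ℂ[X]) :
    ∃ C : ℝ, 0 ≤ C ∧ ∀ x : ℝ, ‖polyGauss p x‖ ≤ C * Real.exp (-|x|) := by
  obtain ⟨C, hC, h⟩ := exists_norm_eval_le_exp_abs p
  refine ⟨C * Real.exp 1, by positivity, fun x => ?_⟩
  have h1 : ‖Complex.exp (-Real.pi * (x : ℂ) ^ 2)‖ = Real.exp (-Real.pi * x ^ 2) := by
    rw [show (-Real.pi * (x : ℂ) ^ 2) = ((-Real.pi * x ^ 2 : ℝ) : ℂ) by push_cast; ring,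
      ← Complex.ofReal_exp, Complex.norm_real, Real.norm_of_nonneg (Real.exp_pos _).le]
  rw [polyGauss, norm_mul, h1]
  calc ‖p.eval (x : ℂ)‖ * Real.exp (-Real.pi * x ^ 2)
      ≤ C * Real.exp |x| * Real.exp (1 - |x| - |x|) := by
        gcongr
        · exact h x
        -- From `(|x| - 1)² ≥ 0`: `-πx² ≤ -x² ≤ 1 - 2|x|`.
        · have hpi := Real.pi_gt_three
          rw [← sq_abs x]
          nlinarith [sq_nonneg (|x| - 1), sq_nonneg |x|]
    _ = C * Real.exp 1 * Real.exp (-|x|) := by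
        rw [mul_assoc, mul_assoc, ← Real.exp_add, ← Real.exp_add]
        ring_nf

theorem iteratedDeriv_polyGauss (p : ℂ[X]) (n : ℕ) :
    ∃ q : ℂ[X], iteratedDeriv n (polyGauss p) = polyGauss q := by
  induction n with
  | zero => exact ⟨p, iteratedDeriv_zero⟩
  | succ n ih =>
    obtain ⟨q, hq⟩ := ih
    refine ⟨derivative q - C (2 * Real.pi : ℂ) * X * q, ?_⟩
    rw [iteratedDeriv_succ, hq]
    exact funext fun x => (hasDerivAt_polyGauss q x).deriv

/-- `p(x) exp(-πx²)` as a Schwartz function. -/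
def polyGaussSchwartz (p : ℂ[X]) : 𝓢(ℝ, ℂ) where
  toFun := polyGauss p
  smooth' := (contDiff_polyGauss p).of_le le_top
  decay' k n := by
    obtain ⟨q, hq⟩ := iteratedDeriv_polyGauss p n
    obtain ⟨C, hC, h⟩ := exists_norm_polyGauss_le (X ^ k * q)
    refine ⟨C, fun x => ?_⟩
    rw [norm_iteratedFDeriv_eq_norm_iteratedDeriv, hq]
    calc ‖x‖ ^ k * ‖polyGauss q x‖ = ‖polyGauss (X ^ k * q) x‖ := by
          simp [polyGauss, mul_assoc]
      _ ≤ C * Real.exp (-|x|) := h x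
      _ ≤ C := mul_le_of_le_one_right hC (Real.exp_le_one_iff.mpr (by simp))

theorem coe_polyGaussSchwartz (p : ℂ[X]) : (polyGaussSchwartz p : ℝ → ℂ) = polyGauss p := rfl

theorem mellinConvergent_polyGauss (p : ℂ[X]) {w : ℂ} (hw : 0 < w.re) :
    MellinConvergent (polyGauss p) w := by
  obtain ⟨C, hC, h⟩ := exists_norm_polyGauss_le p
  refine mellinConvergent_of_isBigO_rpow_exp (a := 1) (b := 0) one_pos
    ((contDiff_polyGauss p).continuous.locallyIntegrable.locallyIntegrableOn _)
    (IsBigO.of_bound C ?_) (IsBigO.of_bound C (Eventually.of_forall fun x => ?_)) hw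
  · filter_upwards [eventually_ge_atTop 0] with x hx
    refine (h x).trans (le_of_eq ?_)
    rw [abs_of_nonneg hx, Real.norm_of_nonneg (Real.exp_pos _).le, neg_one_mul]
  · refine (h x).trans ?_
    rw [neg_zero, Real.rpow_zero, norm_one]
    gcongr
    exact Real.exp_le_one_iff.mpr (by simp)

theorem mellin_polyGauss_add (p q : ℂ[X]) {w : ℂ} (hw : 0 < w.re) :
    mellin (polyGauss (p + q)) w = mellin (polyGauss p) w + mellin (polyGauss q) w := by
  rw [polyGauss_add]
  exact (hasMellin_add (mellinConvergent_polyGauss p hw) (mellinConvergent_polyGauss q hw)).2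

theorem mellin_polyGauss_C_mul (c : ℂ) (p : ℂ[X]) (w : ℂ) :
    mellin (polyGauss (C c * p)) w = c * mellin (polyGauss p) w := by
  rw [polyGauss_C_mul]
  exact mellin_const_smul _ _ c

theorem mellin_polyGauss_sum {ι : Type*} (t : Finset ι) (p : ι → ℂ[X]) {w : ℂ} (hw : 0 < w.re) :
    mellin (polyGauss (∑ i ∈ t, p i)) w = ∑ i ∈ t, mellin (polyGauss (p i)) w := by
  classical
  induction t using Finset.induction_on with
  | empty => simp [polyGauss, mellin]
  | insert i t hi ih => rw [Finset.sum_insert hi, Finset.sum_insert hi, mellin_polyGauss_add _ _ hw, ih]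

/-- Substituting `t ↦ t²` reduces to Euler's integral at `w/2`, with a factor `1/2`. -/
theorem mellin_polyGauss_one {w : ℂ} (hw : 0 < w.re) :
    mellin (polyGauss 1) w = Complex.Gammaℝ w / 2 := by
  have h1 := mellin_comp_rpow (fun t : ℝ => Complex.exp (-(Real.pi : ℂ) * t)) w 2
  have h2 : mellin (fun t : ℝ => Complex.exp (-(Real.pi : ℂ) * t)) (w / (2 : ℝ))
      = Complex.Gammaℝ w := by
    have hw2 : 0 < (w / 2).re := by
      rw [Complex.div_ofNat_re]; positivity
    have := Complex.integral_cpow_mul_exp_neg_mul_Ioi hw2 (r := Real.pi)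
      (by simpa using Real.pi_pos)
    simp only [mellin, smul_eq_mul, neg_mul]
    rw [Complex.ofReal_ofNat, this, Complex.Gammaℝ_def, neg_div, Complex.cpow_neg, one_div,
      Complex.inv_cpow]
    rw [Complex.arg_ofReal_of_nonneg Real.pi_pos.le]
    exact Real.pi_pos.ne
  have h3 : mellin (polyGauss 1) w
      = mellin (fun t : ℝ => Complex.exp (-(Real.pi : ℂ) * ((t ^ (2 : ℝ) : ℝ) : ℂ))) w := by
    congr 1
    ext t
    rw [polyGauss, eval_one, one_mul, Real.rpow_two, Complex.ofReal_pow]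
  rw [h3, h1, h2, abs_of_pos two_pos, Complex.real_smul]
  push_cast
  ring

theorem mellin_polyGauss_X_pow (n : ℕ) {w : ℂ} (hw : 0 < w.re) :
    mellin (polyGauss (X ^ n)) w = Complex.Gammaℝ (w + n) / 2 := by
  rw [← mellin_polyGauss_one (by rw [Complex.add_re, Complex.natCast_re]; positivity),
    ← mellin_cpow_smul]
  congr 1
  ext t
  simp [polyGauss]

/-- Induction on `Γ_ℝ(z + 2) = Γ_ℝ(z) z / (2π)`: at `z = w + 2k` the factor `z/2` is `a + k`. This
is where the rising factorials come from. -/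
theorem pi_pow_mul_Gammaℝ_add (k : ℕ) {w s : ℂ} (hw : 0 < w.re) (hs : w = 1 / 2 - Complex.I * s) :
    (Real.pi : ℂ) ^ k * Complex.Gammaℝ (w + (2 * k : ℕ))
      = Complex.Gammaℝ w * (risingPoly k).eval s := by
  induction k with
  | zero => simp [risingPoly]
  | succ k ih =>
    have h0 : w + (2 * k : ℕ) ≠ 0 := by
      intro h
      have := congrArg Complex.re h
      rw [Complex.add_re, Complex.natCast_re, Complex.zero_re] at this
      have : (0 : ℝ) ≤ (2 * k : ℕ) := Nat.cast_nonneg _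
      linarith
    rw [show w + (2 * (k + 1) : ℕ) = w + (2 * k : ℕ) + 2 by push_cast; ring,
      Complex.Gammaℝ_add_two h0, risingPoly, Finset.prod_range_succ, eval_mul, ← mul_assoc]
    change _ = Complex.Gammaℝ w * (risingPoly k).eval s * _
    rw [← ih, pow_succ]
    have hpi : (Real.pi : ℂ) ≠ 0 := by exact_mod_cast Real.pi_ne_zero
    simp only [eval_sub, eval_mul, eval_C, eval_X]
    field_simp
    rw [hs]
    push_cast
    ring

/-! ### Mellin transforms of the Hermite functions and of `ψ^±_ℓ`. -/

/-- The polynomial `h_{2n}(x) exp(πx²)`. -/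
def hermitePoly (n : ℕ) : ℂ[X] :=
  ∑ k ∈ Finset.range (n + 1), C ((((-1 : ℝ) ^ (n - k) * (2 : ℝ) ^ (-(n : ℝ) + 3 * k + 1 / 4) *
      (√((2 * n)! : ℝ) / ((2 * k)! * (n - k)!)) * Real.pi ^ k : ℝ) : ℂ)) * X ^ (2 * k)

theorem ofReal_hermiteEven (n : ℕ) (x : ℝ) : (hermiteEven n x : ℂ) = polyGauss (hermitePoly n) x := by
  rw [hermiteEven, polyGauss, hermitePoly, eval_finsetSum, Finset.sum_mul, Complex.ofReal_sum]
  refine Finset.sum_congr rfl fun k _ => ?_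
  rw [eval_mul, eval_C, eval_pow, eval_X, Complex.ofReal_mul, Complex.ofReal_mul _ (Real.exp _),
    Complex.ofReal_mul _ (x ^ (2 * k)), Complex.ofReal_mul _ (Real.pi ^ k), Complex.ofReal_exp]
  push_cast
  ring

/-- Here `2^(1/4) = 2 · 2^(-3/4)`; the extra `2` cancels the `1/2` in the Mellin transform of a
monomial times the Gaussian. -/
theorem hermiteCoeff_eq {n k : ℕ} (hk : k ≤ n) :
    (-1 : ℝ) ^ (n - k) * (2 : ℝ) ^ (-(n : ℝ) + 3 * k + 1 / 4) *
      (√((2 * n)! : ℝ) / ((2 * k)! * (n - k)!))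
      = 2 * (2 : ℝ) ^ (-(3 / 4) : ℝ) * (-1) ^ n * √((2 * n)! : ℝ) * calPCoeff n k := by
  have h1 : (2 : ℝ) ^ (-(n : ℝ) + 3 * k + 1 / 4)
      = 2 * (2 : ℝ) ^ (-(3 / 4) : ℝ) * (2 : ℝ) ^ (3 * (k : ℝ) - n) := by
    conv_rhs => rw [← Real.rpow_one_add' (by norm_num) (by norm_num), ← Real.rpow_add (by norm_num)]
    congr 1
    ring
  have h2 : (-1 : ℝ) ^ (n - k) = (-1) ^ n * (-1) ^ k := by
    obtain ⟨j, rfl⟩ := Nat.exists_eq_add_of_le hk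
    rw [Nat.add_sub_cancel_left, pow_add, mul_right_comm, ← pow_add, ← two_mul, pow_mul]
    simp
  rw [h1, h2, calPCoeff]
  ring

theorem mellin_hermitePoly (n : ℕ) {w s : ℂ} (hw : 0 < w.re) (hs : w = 1 / 2 - Complex.I * s) :
    mellin (polyGauss (hermitePoly n)) w =
      Complex.Gammaℝ w * (((2 : ℝ) ^ (-(3 / 4) : ℝ) : ℝ) : ℂ) * ((-1) ^ n * (calP n).eval s) := by
  rw [hermitePoly, mellin_polyGauss_sum _ _ hw, calP_eq, eval_mul, eval_C, eval_finsetSum,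
    Finset.mul_sum, Finset.mul_sum, Finset.mul_sum]
  refine Finset.sum_congr rfl fun k hk => ?_
  rw [mellin_polyGauss_C_mul, mellin_polyGauss_X_pow _ hw,
    hermiteCoeff_eq (Nat.lt_succ_iff.mp (Finset.mem_range.mp hk)), eval_mul, eval_C]
  have := pi_pow_mul_Gammaℝ_add k hw hs
  push_cast at this ⊢
  linear_combination ((2 : ℝ) ^ (-(3 / 4) : ℝ) : ℝ) * (-1) ^ n * (√((2 * n)! : ℝ) : ℂ) *
    (calPCoeff n k : ℂ) * this

theorem hermiteEven_zero (n : ℕ) : (hermiteEven n 0 : ℂ) =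
    2 * (((2 : ℝ) ^ (-(3 / 4) : ℝ) : ℝ) : ℂ) *
      ((-1) ^ n * (calP n).eval (-(Complex.I / 2))) := by
  have h : hermiteEven n 0 = 2 * (2 : ℝ) ^ (-(3 / 4) : ℝ) * (-1) ^ n * √((2 * n)! : ℝ) *
      calPCoeff n 0 := by
    rw [hermiteEven, Finset.sum_range_succ', ← hermiteCoeff_eq (Nat.zero_le n)]
    simp
  have h0 : calPCoeff n 0 = 1 / (2 ^ n * n !) := by
    simp only [calPCoeff, two_rpow_three_mul_sub]
    simp only [pow_zero, mul_zero, Nat.factorial_zero, Nat.sub_zero, Nat.cast_one]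
    field_simp
  rw [h, h0, eval_calP_neg_I_div_two]
  push_cast
  ring

theorem calP_zero : calP 0 = 1 := by
  rw [calP_eq_eval_add, eval_calP_neg_I_div_two]
  simp

theorem calP_one : calP 1 = C (((√2 : ℝ) : ℂ) * Complex.I) * X := by
  rw [calP_eq_eval_add, eval_calP_neg_I_div_two]
  have : calPCoeff 1 1 = -2 := by
    rw [calPCoeff, two_rpow_three_mul_sub]
    norm_num [Nat.factorial]
  have hr : risingPoly 1 = C (1 / 4) - C (Complex.I / 2) * X := by simp [risingPoly]
  rw [Finset.Icc_self, Finset.sum_singleton, this, hr]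
  have h1 : (C (1 / 2) : ℂ[X]) = 2 * C (1 / 4) := by
    rw [show (2 : ℂ[X]) = C 2 from rfl, ← C_mul]; norm_num
  have h2 : (C Complex.I : ℂ[X]) = 2 * C (Complex.I / 2) := by
    rw [show (2 : ℂ[X]) = C 2 from rfl, ← C_mul]; congr 1; ring
  norm_num [Nat.factorial]
  rw [h1, h2, show (C 2 : ℂ[X]) = 2 from rfl]
  ring

/-- The polynomial `ψ⁺_ℓ(x) exp(πx²)`. -/
def psiPlusPoly (l : ℕ) : ℂ[X] :=
  hermitePoly (2 * l) +
    C (-((hermiteEven (2 * l) 0 / hermiteEven 0 0 : ℝ) : ℂ)) * hermitePoly 0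

/-- The polynomial `ψ⁻_ℓ(x) exp(πx²)`. -/
def psiMinusPoly (l : ℕ) : ℂ[X] :=
  C (-1) * hermitePoly (2 * l + 1) +
    C ((hermiteEven (2 * l + 1) 0 / hermiteEven 1 0 : ℝ) : ℂ) * hermitePoly 1

theorem ofReal_psiPlus (l : ℕ) : (fun x => (psiPlus l x : ℂ)) = polyGauss (psiPlusPoly l) := by
  ext x
  rw [psiPlusPoly, polyGauss_add, polyGauss_C_mul]
  simp only [← ofReal_hermiteEven, psiPlus]
  push_cast
  ring

theorem ofReal_psiMinus (l : ℕ) : (fun x => (psiMinus l x : ℂ)) = polyGauss (psiMinusPoly l) := by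
  ext x
  rw [psiMinusPoly, polyGauss_add, polyGauss_C_mul, polyGauss_C_mul]
  simp only [← ofReal_hermiteEven, psiMinus]
  push_cast
  ring

theorem mellin_psiPlusPoly (l : ℕ) {w s : ℂ} (hw : 0 < w.re) (hs : w = 1 / 2 - Complex.I * s) :
    mellin (polyGauss (psiPlusPoly l)) w = Complex.Gammaℝ w * (PPlus l).eval s := by
  have he : (calP (2 * l)).eval (Complex.I / 2) = (calP (2 * l)).eval (-(Complex.I / 2)) := by
    rw [eval_calP_I_div_two, eval_calP_neg_I_div_two, pow_mul]
    simp
  have hc : (((hermiteEven (2 * l) 0 / hermiteEven 0 0 : ℝ)) : ℂ)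
      = (calP (2 * l)).eval (-(Complex.I / 2)) := by
    have := two_rpow_neg_ne_zero
    rw [Complex.ofReal_div, hermiteEven_zero, hermiteEven_zero, calP_zero, pow_mul]
    field_simp
    simp
  rw [psiPlusPoly, mellin_polyGauss_add _ _ hw, mellin_polyGauss_C_mul, mellin_hermitePoly _ hw hs,
    mellin_hermitePoly _ hw hs, hc, PPlus_eq, calP_zero, he, pow_mul]
  simp only [eval_mul, eval_sub, eval_C, eval_one]
  norm_num
  ring

/-- Since `𝒫_1 = √2 i s`, the multiple of `h_2` contributes precisely the linear term `2is
𝒫_{2ℓ+1}(i/2)` of `P^-_ℓ`. -/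
theorem mellin_psiMinusPoly (l : ℕ) {w s : ℂ} (hw : 0 < w.re) (hs : w = 1 / 2 - Complex.I * s) :
    mellin (polyGauss (psiMinusPoly l)) w = Complex.Gammaℝ w * (PMinus l).eval s := by
  have h2 : (((√2 : ℝ) : ℂ)) ≠ 0 := by
    have : (0 : ℝ) < √2 := by positivity
    exact_mod_cast this.ne'
  have h1 : (calP 1).eval (-(Complex.I / 2)) = ((√2 : ℝ) : ℂ) / 2 := by
    rw [calP_one, eval_mul, eval_C, eval_X]
    linear_combination (-((√2 : ℝ) : ℂ) / 2) * Complex.I_mul_I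
  have hc : (((hermiteEven (2 * l + 1) 0 / hermiteEven 1 0 : ℝ)) : ℂ) * ((√2 : ℝ) : ℂ)
      = 2 * (calP (2 * l + 1)).eval (-(Complex.I / 2)) := by
    have := two_rpow_neg_ne_zero
    rw [Complex.ofReal_div, hermiteEven_zero, hermiteEven_zero, h1, pow_succ, pow_mul]
    field_simp
    simp
  rw [psiMinusPoly, mellin_polyGauss_add _ _ hw, mellin_polyGauss_C_mul, mellin_polyGauss_C_mul,
    mellin_hermitePoly _ hw hs, mellin_hermitePoly _ hw hs, PMinus_eq, eval_calP_odd, calP_one,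
    pow_succ, pow_mul]
  generalize (((hermiteEven (2 * l + 1) 0 / hermiteEven 1 0 : ℝ)) : ℂ) = r at hc ⊢
  simp only [eval_mul, eval_add, eval_C, eval_X]
  norm_num
  linear_combination (-Complex.Gammaℝ w * (((2 : ℝ) ^ (-(3 / 4) : ℝ) : ℝ) : ℂ) * Complex.I * s) * hc

/-! ### The Mellin transforms of `E(ψ)` -/

theorem Xi_neg (s : ℂ) : Xi (-s) = Xi s := by
  have h : 1 / 2 + Complex.I * -s = 1 - (1 / 2 + Complex.I * s) := by ring
  rw [Xi, Xi, h, completedRiemannZeta₀_one_sub]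
  ring

theorem Xi_eq_completedRiemannZeta {s w : ℂ} (hw : w = 1 / 2 - Complex.I * s) (h0 : w ≠ 0)
    (h1 : w ≠ 1) : Xi s = -(1 / 2) * (1 / 4 + s ^ 2) * completedRiemannZeta w := by
  have h1' : 1 - w ≠ 0 := sub_ne_zero.mpr (Ne.symm h1)
  have h2 : 1 / 2 + Complex.I * -s = w := by rw [hw]; ring
  have h3 : -(1 / 2) * (1 / 4 + s ^ 2) = w * (w - 1) / 2 := by
    rw [hw]
    linear_combination (-s ^ 2 / 2) * Complex.I_sq
  rw [← Xi_neg, Xi, h2, h3, completedRiemannZeta_eq]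
  field_simp
  ring

theorem integral_eq_two_mul_mellin_one {f : ℝ → ℂ} (hf : Integrable f)
    (heven : ∀ x, f (-x) = f x) : ∫ x, f x = 2 * mellin f 1 := by
  have h1 : mellin f 1 = ∫ x in Set.Ioi (0 : ℝ), f x := by simp [mellin]
  have h2 : ∫ x in Set.Iic (0 : ℝ), f x = ∫ x in Set.Ioi (0 : ℝ), f x := by
    have := integral_comp_neg_Ioi 0 f
    rw [neg_zero] at this
    rw [← this]
    simp only [heven]
  rw [h1, ← integral_add_compl measurableSet_Iic hf, Set.compl_Iic, h2, two_mul]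

/-- The properties of `p(x) exp(-πx²)` used to compute the Mellin transform of its image under `E`:
it is even and vanishes at `0`, and its Mellin transform at `1/2 - is` is, up to the archimedean
factor, the polynomial `-(1/2)(1/4 + s²) R(s)`. -/
structure IsZetaPair (p R : ℂ[X]) : Prop where
  even : ∀ x, polyGauss p (-x) = polyGauss p x
  zero : polyGauss p 0 = 0
  mellin_eq : ∀ {w s : ℂ}, 0 < w.re → w = 1 / 2 - Complex.I * s → mellin (polyGauss p) w =
    Complex.Gammaℝ w * (C (-(1 / 2)) * (C (1 / 4) + X ^ 2) * R).eval s

namespace IsZetaPair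

variable {p R : ℂ[X]}

/-- The integral is twice the Mellin transform at `w = 1`, that is `s = i/2`, where `1/4 + s²`
vanishes. -/
theorem integral_eq_zero (h : IsZetaPair p R) : ∫ x, polyGaussSchwartz p x = 0 := by
  rw [integral_eq_two_mul_mellin_one (polyGaussSchwartz p).integrable h.even, coe_polyGaussSchwartz,
    h.mellin_eq (s := Complex.I / 2) (by simp) (by linear_combination Complex.I_mul_I / 2)]
  have : (1 / 4 + (Complex.I / 2) ^ 2 : ℂ) = 0 := by linear_combination Complex.I_sq / 4
  simp only [eval_mul, eval_add, eval_pow, eval_X, eval_C, this]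
  simp

theorem mellinConvergent (h : IsZetaPair p R) (z : ℂ) :
    MellinConvergent (mapEC (polyGauss p)) z :=
  mellinConvergent_mapEC (polyGaussSchwartz p) h.even h.zero h.integral_eq_zero z

/-- For `Im s > 1/2` one has `Re w > 1`, so `ζ(w) Γ_ℝ(w)` appears and, with `-(1/4 + s²)/2 = w(w -
1)/2`, assembles to `Ξ`. Both sides are entire and agree near `i`, hence everywhere. -/
theorem mellin_mapEC_eq (h : IsZetaPair p R) (s : ℂ) :
    mellin (mapEC (polyGauss p)) (-(Complex.I * s)) = R.eval s * Xi s := by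
  have hd : Differentiable ℂ fun s : ℂ => mellin (mapEC (polyGauss p)) (-(Complex.I * s)) :=
    (differentiable_mellin_mapEC (polyGaussSchwartz p) h.even h.zero h.integral_eq_zero).comp
      (by fun_prop)
  have hd' : Differentiable ℂ fun s : ℂ => R.eval s * Xi s :=
    R.differentiable.mul differentiable_Xi
  have hopen : IsOpen {s : ℂ | 1 / 2 < s.im} := isOpen_lt continuous_const Complex.continuous_im
  have hev : (fun s : ℂ => mellin (mapEC (polyGauss p)) (-(Complex.I * s)))
      =ᶠ[𝓝 Complex.I] fun s => R.eval s * Xi s := by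
    filter_upwards [hopen.mem_nhds (show (1 / 2 : ℝ) < Complex.I.im by norm_num)] with s hs
    have hs : 1 / 2 < s.im := hs
    obtain ⟨w, hw⟩ : ∃ w : ℂ, w = 1 / 2 - Complex.I * s := ⟨_, rfl⟩
    have hre : 1 < w.re := by
      rw [hw]
      simp
      linarith
    have h0 : w ≠ 0 := by rintro rfl; norm_num at hre
    have h1 : w ≠ 1 := by rintro rfl; norm_num at hre
    have hG : Complex.Gammaℝ w ≠ 0 := Complex.Gammaℝ_ne_zero_of_re_pos (by linarith)
    rw [show -(Complex.I * s) = w - 1 / 2 by rw [hw]; ring,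
      mellin_mapEC (mellinConvergent_polyGauss p (by linarith)) hre,
      h.mellin_eq (by linarith) hw, riemannZeta_def_of_ne_zero h0,
      Xi_eq_completedRiemannZeta hw h0 h1]
    simp only [eval_mul, eval_add, eval_pow, eval_X, eval_C]
    field_simp
  exact congrFun (AnalyticOnNhd.eq_of_eventuallyEq (hd.differentiableOn.analyticOnNhd isOpen_univ
    |>.mono (Set.subset_univ _)) (hd'.differentiableOn.analyticOnNhd isOpen_univ) hev) s

end IsZetaPair

theorem hermiteEven_neg (n : ℕ) (x : ℝ) : hermiteEven n (-x) = hermiteEven n x := by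
  simp [hermiteEven, pow_mul]

theorem hermiteEven_zero_ne_zero (n : ℕ) : hermiteEven n 0 ≠ 0 := by
  have h := hermiteEven_zero n
  rw [eval_calP_neg_I_div_two] at h
  have h1 : (0 : ℝ) < √((2 * n)! : ℝ) * (1 / (2 ^ n * n !)) := by positivity
  have h2 := two_rpow_neg_ne_zero
  have h3 : ((√((2 * n)! : ℝ) * (1 / (2 ^ n * n !)) : ℝ) : ℂ) ≠ 0 := by exact_mod_cast h1.ne'
  intro h0
  rw [h0, Complex.ofReal_zero, eq_comm, mul_eq_zero, mul_eq_zero, mul_eq_zero] at h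
  simp [h2] at h
  exact h3 (by push_cast; simpa using h)

theorem isZetaPair_psiPlusPoly (l : ℕ) : IsZetaPair (psiPlusPoly l) (RPlus l) where
  even x := by
    simp only [← ofReal_psiPlus, psiPlus, hermiteEven_neg]
  zero := by
    have := hermiteEven_zero_ne_zero 0
    simp only [← ofReal_psiPlus, psiPlus]
    rw [div_mul_cancel₀ _ this, sub_self, Complex.ofReal_zero]
  mellin_eq hw hs := by rw [mellin_psiPlusPoly l hw hs, ← PPlus_eq_mul_RPlus]

theorem isZetaPair_psiMinusPoly (l : ℕ) : IsZetaPair (psiMinusPoly l) (RMinus l) where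
  even x := by
    simp only [← ofReal_psiMinus, psiMinus, hermiteEven_neg]
  zero := by
    have := hermiteEven_zero_ne_zero 1
    simp only [← ofReal_psiMinus, psiMinus]
    rw [div_mul_cancel₀ _ this, neg_add_cancel, Complex.ofReal_zero]
  mellin_eq hw hs := by rw [mellin_psiMinusPoly l hw hs, ← PMinus_eq_mul_RMinus]

theorem ofReal_mapE_psiPlus (l : ℕ) :
    (fun u => (mapE (psiPlus l) u : ℂ)) = mapEC (polyGauss (psiPlusPoly l)) := by
  rw [← ofReal_psiPlus]
  exact funext fun u => ofReal_mapE _ u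

theorem ofReal_mapE_psiMinus (l : ℕ) :
    (fun u => (mapE (psiMinus l) u : ℂ)) = mapEC (polyGauss (psiMinusPoly l)) := by
  rw [← ofReal_psiMinus]
  exact funext fun u => ofReal_mapE _ u

theorem fourierMu_mapE_psiPlus (l : ℕ) (s : ℂ) :
    fourierMu (mapE (psiPlus l)) s = (RPlus l).eval s * Xi s := by
  rw [fourierMu, ofReal_mapE_psiPlus, (isZetaPair_psiPlusPoly l).mellin_mapEC_eq]

theorem fourierMu_mapE_psiMinus (l : ℕ) (s : ℂ) :
    fourierMu (mapE (psiMinus l)) s = (RMinus l).eval s * Xi s := by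
  rw [fourierMu, ofReal_mapE_psiMinus, (isZetaPair_psiMinusPoly l).mellin_mapEC_eq]

theorem summable_psiPlus (l : ℕ) {u : ℝ} (hu : 0 < u) :
    Summable fun n : ℕ => psiPlus l (((n : ℝ) + 1) * u) := by
  have := summable_dilate (polyGaussSchwartz (psiPlusPoly l)) hu
  rw [coe_polyGaussSchwartz, ← ofReal_psiPlus] at this
  exact Complex.summable_ofReal.mp this

theorem summable_psiMinus (l : ℕ) {u : ℝ} (hu : 0 < u) :
    Summable fun n : ℕ => psiMinus l (((n : ℝ) + 1) * u) := by
  have := summable_dilate (polyGaussSchwartz (psiMinusPoly l)) hu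
  rw [coe_polyGaussSchwartz, ← ofReal_psiMinus] at this
  exact Complex.summable_ofReal.mp this

/-! ### The growth of `Ξ` -/

/-- For `t ≥ 1`, Young's inequality bounds `σ log t` by `σ^(1+ε) + (log t)^q` with `q` conjugate to
`1 + ε`, and `(log t)^q ≤ K + t/2`. -/
theorem exists_rpow_le_exp {ε : ℝ} (hε : 0 < ε) : ∃ K : ℝ, ∀ σ t : ℝ, 0 ≤ σ → 0 < t →
    t ^ σ ≤ Real.exp (K + σ ^ (1 + ε)) * Real.exp (t / 2) := by
  have hpq := Real.HolderConjugate.conjExponent (p := 1 + ε) (by linarith)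
  set q := Real.conjExponent (1 + ε)
  have hq : 0 < q := hpq.symm.pos
  obtain ⟨T, hT⟩ := eventually_atTop.mp
    ((isLittleO_log_rpow_rpow_atTop q one_pos).bound (half_pos one_pos))
  set M := max T 1
  have hM : 0 ≤ Real.log M := Real.log_nonneg (le_max_right _ _)
  refine ⟨Real.log M ^ q, fun σ t hσ ht => ?_⟩
  rw [← Real.exp_add]
  have hσ' : 0 ≤ σ ^ (1 + ε) := by positivity
  have hM' : 0 ≤ Real.log M ^ q := by positivity
  rcases le_total t 1 with h1 | h1
  · exact (Real.rpow_le_one ht.le h1 hσ).trans (Real.one_le_exp (by positivity))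
  · have hlog : 0 ≤ Real.log t := Real.log_nonneg h1
    have hlogq : Real.log t ^ q ≤ Real.log M ^ q + t / 2 := by
      rcases le_total t M with h2 | h2
      · have : Real.log t ^ q ≤ Real.log M ^ q := by gcongr
        linarith
      · have := hT t ((le_max_left _ _).trans h2)
        rw [Real.norm_of_nonneg (by positivity), Real.rpow_one, Real.norm_of_nonneg ht.le] at this
        linarith
    rw [Real.rpow_def_of_pos ht, Real.exp_le_exp]
    have hy := Real.young_inequality_of_nonneg hσ hlog hpq
    have h3 : σ ^ (1 + ε) / (1 + ε) ≤ σ ^ (1 + ε) := div_le_self hσ' (by linarith)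
    have h4 : Real.log t ^ q / q ≤ Real.log t ^ q :=
      div_le_self (by positivity) hpq.symm.lt.le
    linarith

/-- Since `(n + 1)u ≥ u + n` for `u ≥ 1`, the series is dominated by `exp(-u)` times a geometric
series; `√u` costs `exp(u/4)`. The rate `3/4` leaves room for the weight `exp(u/2)`. -/
theorem exists_norm_mapEC_polyGauss_le (p : ℂ[X]) :
    ∃ C : ℝ, ∀ u : ℝ, 1 ≤ u → ‖mapEC (polyGauss p) u‖ ≤ C * Real.exp (-(3 / 4) * u) := by
  obtain ⟨C, hC, h⟩ := exists_norm_polyGauss_le p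
  have hgeom := hasSum_geometric_of_lt_one (Real.exp_pos (-1)).le
    (Real.exp_lt_one_iff.mpr (by norm_num : (-1 : ℝ) < 0))
  set G := (1 - Real.exp (-1))⁻¹
  have hG : 0 ≤ G := hgeom.nonneg fun n => by positivity
  refine ⟨4 * (C * G), fun u hu => ?_⟩
  have hS : ‖dilateSum (polyGauss p) u‖ ≤ C * Real.exp (-u) * G := by
    refine tsum_of_norm_bounded (hgeom.mul_left _) fun n => (h _).trans ?_
    rw [abs_of_nonneg (by positivity), mul_assoc, ← Real.exp_nat_mul, ← Real.exp_add]
    gcongr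
    nlinarith [mul_nonneg (Nat.cast_nonneg (α := ℝ) n) (sub_nonneg.mpr hu)]
  have hsqrt : √u ≤ 4 * Real.exp (u / 4) := by
    have h1 : √u ≤ u := Real.sqrt_le_iff.mpr ⟨by linarith, by nlinarith⟩
    have h2 := Real.add_one_le_exp (u / 4)
    linarith
  rw [norm_mapEC]
  calc √u * ‖dilateSum (polyGauss p) u‖
      ≤ 4 * Real.exp (u / 4) * (C * Real.exp (-u) * G) := by gcongr
    _ = 4 * (C * G) * (Real.exp (u / 4) * Real.exp (-u)) := by ring
    _ = 4 * (C * G) * Real.exp (-(3 / 4) * u) := by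
        rw [← Real.exp_add]
        ring_nf

namespace IsZetaPair

variable {p R : ℂ[X]}

theorem mellinConvergent_exp_mul (h : IsZetaPair p R) :
    MellinConvergent (fun u => (Real.exp (u / 2) : ℂ) * mapEC (polyGauss p) u) 0 := by
  obtain ⟨C, hC⟩ := exists_norm_mapEC_polyGauss_le p
  refine mellinConvergent_of_isBigO_rpow_exp (a := 1 / 4) (b := -((2 : ℕ) - 1 / 2)) (by norm_num)
    ?_ (IsBigO.of_bound C ?_) ?_ (by norm_num)
  · refine ContinuousOn.locallyIntegrableOn ?_ measurableSet_Ioi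
    refine ContinuousOn.mul (by fun_prop) (ContinuousOn.mul (by fun_prop) ?_)
    exact continuousOn_dilateSum (polyGaussSchwartz p)
  · filter_upwards [eventually_ge_atTop 1] with u hu
    rw [norm_mul, Complex.norm_real, Real.norm_of_nonneg (Real.exp_pos _).le,
      Real.norm_of_nonneg (Real.exp_pos _).le]
    calc Real.exp (u / 2) * ‖mapEC (polyGauss p) u‖
        ≤ Real.exp (u / 2) * (C * Real.exp (-(3 / 4) * u)) := by gcongr; exact hC u hu
      _ = C * (Real.exp (u / 2) * Real.exp (-(3 / 4) * u)) := by ring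
      _ = C * Real.exp (-(1 / 4) * u) := by
          rw [← Real.exp_add]
          ring_nf
  · have h1 : (fun u : ℝ => (Real.exp (u / 2) : ℂ)) =O[𝓝[>] 0] fun _ => (1 : ℝ) := by
      have : ContinuousAt (fun u : ℝ => (Real.exp (u / 2) : ℂ)) 0 := by fun_prop
      exact (this.tendsto.isBigO_one ℝ).mono nhdsWithin_le_nhds
    have h2 := h1.mul
      (mapEC_isBigO_zero (polyGaussSchwartz p) h.even h.zero h.integral_eq_zero le_rfl)
    simpa only [one_mul, coe_polyGaussSchwartz] using h2

/-- In the Mellin integral `|t^(-is)| = t^(Im s)`, which `exists_rpow_le_exp` separates into a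
factor in `s` and the weight `exp(t/2)`; the weighted integral is finite. -/
theorem exists_norm_eval_mul_Xi_le (h : IsZetaPair p R) {ε : ℝ} (hε : 0 < ε) :
    ∃ A : ℝ, ∀ s : ℂ, 0 ≤ s.im → ‖R.eval s * Xi s‖ ≤ A * Real.exp (‖s‖ ^ (1 + ε)) := by
  obtain ⟨K, hK⟩ := exists_rpow_le_exp hε
  have hint := h.mellinConvergent_exp_mul.norm
  set B := ∫ t in Set.Ioi (0 : ℝ),
    ‖(t : ℂ) ^ ((0 : ℂ) - 1) • ((Real.exp (t / 2) : ℂ) * mapEC (polyGauss p) t)‖ with hB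
  have hB0 : 0 ≤ B := integral_nonneg fun _ => norm_nonneg _
  refine ⟨Real.exp K * B, fun s hs => ?_⟩
  rw [← h.mellin_mapEC_eq, mellin]
  have hbound : ‖∫ t in Set.Ioi (0 : ℝ),
      (t : ℂ) ^ (-(Complex.I * s) - 1) • mapEC (polyGauss p) t‖
      ≤ Real.exp (K + s.im ^ (1 + ε)) * B := by
    rw [hB, ← integral_const_mul]
    refine norm_integral_le_of_norm_le (hint.const_mul _) ?_
    filter_upwards [ae_restrict_mem measurableSet_Ioi] with t ht
    have ht : 0 < t := ht
    rw [norm_smul, norm_smul, norm_mul, Complex.norm_cpow_eq_rpow_re_of_pos ht,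
      Complex.norm_cpow_eq_rpow_re_of_pos ht, Complex.norm_real,
      Real.norm_of_nonneg (Real.exp_pos _).le]
    have h1 : (-(Complex.I * s) - 1).re = s.im + ((0 : ℂ) - 1).re := by
      simp
      ring
    rw [h1, Real.rpow_add ht]
    calc t ^ s.im * t ^ ((0 : ℂ) - 1).re * ‖mapEC (polyGauss p) t‖
        ≤ Real.exp (K + s.im ^ (1 + ε)) * Real.exp (t / 2) * t ^ ((0 : ℂ) - 1).re *
          ‖mapEC (polyGauss p) t‖ := by
          gcongr
          exact hK s.im t hs ht
      _ = _ := by ring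
  refine hbound.trans ?_
  have him : s.im ≤ ‖s‖ := (le_abs_self _).trans (Complex.abs_im_le_norm s)
  calc Real.exp (K + s.im ^ (1 + ε)) * B ≤ Real.exp (K + ‖s‖ ^ (1 + ε)) * B := by gcongr
    _ = Real.exp K * B * Real.exp (‖s‖ ^ (1 + ε)) := by rw [Real.exp_add]; ring

end IsZetaPair

/-- `R⁺_1` is a nonzero constant, so the bound for `R⁺_1 Ξ` gives one for `Ξ` on the upper
half-plane; evenness covers the lower one. -/
theorem exists_norm_Xi_le {ε : ℝ} (hε : 0 < ε) :
    ∃ A : ℝ, ∀ s : ℂ, ‖Xi s‖ ≤ A * Real.exp (‖s‖ ^ (1 + ε)) := by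
  obtain ⟨A, hA⟩ := (isZetaPair_psiPlusPoly 1).exists_norm_eval_mul_Xi_le hε
  have hdeg : (RPlus 1).degree = 0 := degree_RPlus 0
  obtain ⟨c, hc⟩ : ∃ c, RPlus 1 = C c := ⟨_, eq_C_of_degree_eq_zero hdeg⟩
  have hc0 : c ≠ 0 := by
    rintro rfl
    rw [hc, C_0, degree_zero] at hdeg
    exact absurd hdeg (by simp)
  have hpos : 0 < ‖c‖ := norm_pos_iff.mpr hc0
  have key (s : ℂ) (hs : 0 ≤ s.im) : ‖Xi s‖ ≤ A / ‖c‖ * Real.exp (‖s‖ ^ (1 + ε)) := by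
    have := hA s hs
    rw [hc, eval_C, norm_mul] at this
    rw [div_mul_eq_mul_div, le_div_iff₀ hpos, mul_comm]
    exact this
  refine ⟨A / ‖c‖, fun s => ?_⟩
  rcases le_total 0 s.im with hs | hs
  · exact key s hs
  · have := key (-s) (by rw [Complex.neg_im]; linarith)
    rwa [Xi_neg, norm_neg] at this

/-- `Ξ` as an element of `H_{≤1}`. -/
def XiH : HadamardRing := ⟨Xi, differentiable_Xi, fun _ hε => exists_norm_Xi_le hε⟩

theorem toFun_XiH : XiH.toFun = Xi := rfl

theorem toFun_polyMul_RPlus (l : ℕ) :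
    (HadamardRing.polyMul XiH (RPlus l)).toFun = fourierMu (mapE (psiPlus l)) := by
  ext s
  rw [HadamardRing.toFun_polyMul, fourierMu_mapE_psiPlus, toFun_XiH]

theorem toFun_polyMul_RMinus (l : ℕ) :
    (HadamardRing.polyMul XiH (RMinus l)).toFun = fourierMu (mapE (psiMinus l)) := by
  ext s
  rw [HadamardRing.toFun_polyMul, fourierMu_mapE_psiMinus, toFun_XiH]

theorem closedSpan_eq : closedSpan = HadamardRing.closedPolySpan XiH := by
  have hset : {f : HadamardRing | ∃ l : ℕ, f.toFun = fourierMu (mapE (psiPlus l)) ∨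
      f.toFun = fourierMu (mapE (psiMinus l))}
      = HadamardRing.polyMul XiH '' (Set.range RPlus ∪ Set.range RMinus) := by
    ext f
    constructor
    · rintro ⟨l, h | h⟩
      · exact ⟨RPlus l, Or.inl ⟨l, rfl⟩, HadamardRing.toFun_injective
          ((toFun_polyMul_RPlus l).trans h.symm)⟩
      · exact ⟨RMinus l, Or.inr ⟨l, rfl⟩, HadamardRing.toFun_injective
          ((toFun_polyMul_RMinus l).trans h.symm)⟩
    · rintro ⟨_, ⟨l, rfl⟩ | ⟨l, rfl⟩, rfl⟩
      · exact ⟨l, Or.inl (toFun_polyMul_RPlus l)⟩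
      · exact ⟨l, Or.inr (toFun_polyMul_RMinus l)⟩
  rw [closedSpan, hset, ← Submodule.map_span, span_RPlus_union_RMinus, Submodule.map_top,
    HadamardRing.closedPolySpan]

/-! ### The zeros of `Ξ` -/

theorem Xi_eq_zero_iff_of_forall_ne {s z : ℂ} (hz : z = 1 / 2 + Complex.I * s) (h1 : z ≠ 1)
    (hpole : ∀ n : ℕ, z ≠ -(2 * n)) : Xi s = 0 ↔ riemannZeta z = 0 := by
  have h0 : z ≠ 0 := by simpa using hpole 0
  have hG : Complex.Gamma (z / 2) ≠ 0 := Complex.Gamma_ne_zero fun n h => hpole n (by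
    linear_combination 2 * h)
  have hpi : (Real.pi : ℂ) ^ (-z / 2) ≠ 0 := by
    rw [Ne, Complex.cpow_eq_zero_iff]
    exact fun h => Real.pi_ne_zero (by exact_mod_cast h.1)
  rw [Xi_eq s z hz h1 hpole]
  simp [h0, hG, hpi, sub_ne_zero.mpr h1]

/-- At `z = 0` and `z = 1`, `Ξ` equals `1/2`. At a trivial zero `z`, evenness moves to `1 - z`,
where `Re > 1` and `ζ ≠ 0`. Elsewhere all factors of `Ξ` other than `ζ` are nonzero. -/
theorem Xi_eq_zero_iff (s : ℂ) : Xi s = 0 ↔ IsNontrivialZetaZero (1 / 2 + Complex.I * s) := by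
  obtain ⟨z, hz⟩ : ∃ z : ℂ, z = 1 / 2 + Complex.I * s := ⟨_, rfl⟩
  have hXi : Xi s = z * (z - 1) / 2 * completedRiemannZeta₀ z + 1 / 2 := by rw [hz, Xi]
  rw [← hz, IsNontrivialZetaZero]
  by_cases h1 : z = 1
  · simp [hXi, h1]
  by_cases hpole : ∃ n : ℕ, z = -(2 * n)
  · obtain ⟨n, hn⟩ := hpole
    rcases n with _ | n
    · have h0 : z = 0 := by simpa using hn
      simp [hXi, h0, riemannZeta_zero]
    · refine iff_of_false ?_ fun h => h.2.2 ⟨n, by rw [hn]; push_cast; ring⟩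
      have hz' : 1 - z = 1 / 2 + Complex.I * -s := by rw [hz]; ring
      have hre : (1 - z).re = 1 + 2 * ((n : ℝ) + 1) := by
        rw [hn]
        simp
      have hre1 : 1 < (1 - z).re := by rw [hre]; linarith [(Nat.cast_nonneg n : (0 : ℝ) ≤ n)]
      rw [← Xi_neg, Xi_eq_zero_iff_of_forall_ne hz' (fun h => by norm_num [h] at hre1)]
      · exact riemannZeta_ne_zero_of_one_lt_re hre1
      · intro m h
        rw [h] at hre1
        simp at hre1
        linarith [(Nat.cast_nonneg m : (0 : ℝ) ≤ m)]
  · push Not at hpole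
    rw [Xi_eq_zero_iff_of_forall_ne hz h1 hpole]
    refine ⟨fun h => ⟨h, h1, ?_⟩, fun h => h.1⟩
    rintro ⟨n, hn⟩
    exact hpole (n + 1) (by rw [hn]; push_cast; ring)

end HermiteZeta

end

theorem mainTheorem4 :
    -- the polynomials `P^±_ℓ` come from the `𝒫_m`, and `P^±_ℓ = -(1/2)(1/4 + s²) R^±_ℓ`
    (∀ l : ℕ,
      PPlus l = C (((2 : ℝ) ^ (-(3 / 4) : ℝ) : ℝ) : ℂ) *
          (calP (2 * l) - C ((calP (2 * l)).eval (Complex.I / 2))) ∧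
      PMinus l = C (((2 : ℝ) ^ (-(3 / 4) : ℝ) : ℝ) : ℂ) *
          (calP (2 * l + 1) + C (2 * Complex.I * (calP (2 * l + 1)).eval (Complex.I / 2)) * X) ∧
      PPlus l = C (-(1 / 2)) * (C (1 / 4) + X ^ 2) * RPlus l ∧
      PMinus l = C (-(1 / 2)) * (C (1 / 4) + X ^ 2) * RMinus l) ∧
    -- every polynomial is a linear combination of the `R^±_ℓ`
    Submodule.span ℂ (Set.range RPlus ∪ Set.range RMinus) = ⊤ ∧
    -- the series defining `E(ψ^±_ℓ)` converge
    (∀ l : ℕ, ∀ u : ℝ, 0 < u →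
      Summable (fun n : ℕ => psiPlus l (((n : ℝ) + 1) * u)) ∧
      Summable (fun n : ℕ => psiMinus l (((n : ℝ) + 1) * u))) ∧
    -- (i)
    (∀ l : ℕ, ∀ s : ℂ,
      (FourierMuConvergent (mapE (psiPlus l)) s ∧
        fourierMu (mapE (psiPlus l)) s = (RPlus l).eval s * Xi s) ∧
      (FourierMuConvergent (mapE (psiMinus l)) s ∧
        fourierMu (mapE (psiMinus l)) s = (RMinus l).eval s * Xi s)) ∧
    -- (ii): the functions lie in `H_{≤1}`, their closed span is stable under multiplication by `s`,
    -- and the spectrum of the operator induced on the quotient is as claimed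
    (∀ l : ℕ,
      fourierMu (mapE (psiPlus l)) ∈ entireOrderLEOne ∧
      fourierMu (mapE (psiMinus l)) ∈ entireOrderLEOne) ∧
    ∃ hstable : ∀ f ∈ closedSpan, HadamardRing.mulS f ∈ closedSpan,
      spectrum ℂ (HadamardRing.quotientMulS closedSpan hstable) =
        {s : ℂ | IsNontrivialZetaZero (1 / 2 + Complex.I * s)} := by
  refine ⟨fun l => ⟨PPlus_eq l, PMinus_eq l, PPlus_eq_mul_RPlus l, PMinus_eq_mul_RMinus l⟩,
    span_RPlus_union_RMinus, fun l u hu => ⟨summable_psiPlus l hu, summable_psiMinus l hu⟩,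
    fun l s => ⟨⟨?_, fourierMu_mapE_psiPlus l s⟩, ?_, fourierMu_mapE_psiMinus l s⟩,
    fun l => ⟨?_, ?_⟩, ?_⟩
  · rw [FourierMuConvergent, ofReal_mapE_psiPlus]
    exact (isZetaPair_psiPlusPoly l).mellinConvergent _
  · rw [FourierMuConvergent, ofReal_mapE_psiMinus]
    exact (isZetaPair_psiMinusPoly l).mellinConvergent _
  · rw [← toFun_polyMul_RPlus]
    exact (HadamardRing.polyMul XiH (RPlus l)).2
  · rw [← toFun_polyMul_RMinus]
    exact (HadamardRing.polyMul XiH (RMinus l)).2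
  · rw [closedSpan_eq]
    refine ⟨HadamardRing.mulS_mem_closedPolySpan XiH, ?_⟩
    rw [HadamardRing.spectrum_quotientMulS]
    ext s
    exact Xi_eq_zero_iff s
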